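/- **Conventions.** For linear orders, $L_1+L_2$ is the sum and $L_1\times L_2$ is the lexicographic product in which the first coordinate dominates (so $\omega\times L$ is a sum of $\omega$ copies of $L$). Put $\omega^{+}=\omega$, $\omega^{-}=\omega^*$ (the reverse of $\omega$), $\omega^0=\mathbf 1$. The class $\mathrm{LO}_{\mathrm{fp}}$ of finitely presented linear orders is the smallest class of linear orders that is closed under isomorphism, contains $\mathbf 0$ and $\mathbf 1$, and contains $L_1+L_2$, $\omega\times L$ and $\omega^*\times L$ whenever it contains $L_1,L_2,L$. A *3-signed tree* is a pair $(T,s_T)$ where $T$ is a finite non-empty rooted tree in which the children of each vertex are linearly ordered (equivalently, a finite tree $T\subseteq\omega^{<\omega}$ in which the children of $\sigma$ are $\sigma*0,\dots,\sigma*(w-1)$ for some $w$), and $s_T:T\to\{+,-,0\}$ satisfies $s_T(\sigma)=0$ if and only if $\sigma$ is the root or a leaf. Trees are identified if they are isomorphic as ordered signed trees. Put $\mathrm{LIN}(T,s_T)=\mathbf 0$ if $|T|=1$; otherwise $\mathrm{LIN}(T,s_T)=\mathrm{LIN}(T,s_T,\emptyset)$, where, for a vertex $\sigma$ with children $\sigma_1<\dots<\sigma_n$,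 $$\mathrm{LIN}(T,s_T,\sigma)=\omega^{s_T(\sigma)}\times\bigl(\mathrm{LIN}(T,s_T,\sigma_1)+\dots+\mathrm{LIN}(T,s_T,\sigma_n)\bigr),$$ the sum being read as $\mathbf 1$ if $n=0$. Let $\sigma\in T$ with $s_T(\sigma)\ne0$, and let $t_1,\dots,t_n$ ($n\ge1$) be the subtrees induced by the children of $\sigma$, in order. The tree $\mathsf{EXUDE}((T,s_T);\sigma)$ is obtained from $T$ by replacing, in the list of child subtrees of the parent of $\sigma$, the subtree at $\sigma$ by two consecutive subtrees: if $s_T(\sigma)=+$, by $t_1$ followed by a vertex of sign $+$ with child subtrees $t_2,\dots,t_n,t_1$; if $s_T(\sigma)=-$, by a vertex of sign $-$ with child subtrees $t_n,t_1,\dots,t_{n-1}$, followed by $t_n$. For $m\ge1$ the tree $m\text{-}\mathsf{REPL}((T,s_T);\sigma)$ is obtained from $T$ by replacing the list $t_1,\dots,t_n$ of child subtrees of $\sigma$ by $m$ consecutive copies of it. *L-equivalence* $\approx_L$ is the equivalence relation on 3-signed trees generated by $(T,s_T)\approx_L\mathsf{EXUDE}((T,s_T);\sigma)$ and $(T,s_T)\approx_L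 m\text{-}\mathsf{REPL}((T,s_T);\sigma)$ for all $(T,s_T)$, all $\sigma\in T$ with $s_T(\sigma)\neq 0$ and all $m\ge1$. **Theorem.** 1. If $(T,s_T)$ and $(T',s_{T'})$ are 3-signed trees with $\mathrm{LIN}(T,s_T)\cong\mathrm{LIN}(T',s_{T'})$, then $(T,s_T)\approx_L(T',s_{T'})$. 2. Conversely, if $(T,s_T)\approx_L(T',s_{T'})$, then $\mathrm{LIN}(T,s_T)\cong\mathrm{LIN}(T',s_{T'})$. 3. A linear order $L$ is finitely presented if and only if $L\cong\mathrm{LIN}(T,s_T)$ for some 3-signed tree $(T,s_T)$. Hence $\mathrm{LIN}$ induces a bijection between the L-equivalence classes of 3-signed trees and the isomorphism types of finitely presented linear orders. -/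

import Mathlib

universe u

/-! ### Finite signed rooted trees

A finite subset `T` of `ω^{<ω}` that is a tree and has the standard labelling
(`σ * x ∈ T ↔ x < w(T; σ)`) together with a map `s_T : T → {+, -, 0}` is the same thing as a finite
ordered rooted tree whose vertices carry signs. A vertex is addressed by the finite sequence of
child indices (counted from `0`) that leads to it from the root; the root has address `[]`. -/

/-- Finite ordered rooted trees with a sign (`1`, `-1` or `0`) at each vertex. -/
inductive SgnTree : Type
  | node (s : SignType) (children : List SgnTree) : SgnTree

namespace SgnTree

/-- The sign of the root. -/
def rootSign : SgnTree → SignType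
  | node s _ => s

/-- The list of the subtrees induced by the children of the root. -/
def children : SgnTree → List SgnTree
  | node _ ts => ts

/-- The subtree induced by the vertex with address `σ`; it is `none` if there is no such vertex. -/
def sub : SgnTree → List ℕ → Option SgnTree
  | t, [] => some t
  | node _ ts, k :: σ => (ts[k]?).bind fun t => sub t σ

/-- `s_T(σ) = 0` if and only if the vertex `σ` is the root or a leaf. -/
def IsThreeSigned (T : SgnTree) : Prop :=
  ∀ (σ : List ℕ) (t : SgnTree), T.sub σ = some t →
    (t.rootSign = 0 ↔ σ = [] ∨ t.children = [])

/-- The linear order `ω^s`: `ω^0 = 1`, `ω^+ = ω` and `ω^- = ω^*`. -/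
def omegaPow : SignType → LinOrd.{0}
  | .zero => LinOrd.of Unit
  | .pos => LinOrd.of ℕ
  | .neg => LinOrd.of ℕᵒᵈ

mutual

/-- The order `LIN(T, s_T, σ)`, as a function of the subtree induced by `σ`: the lexicographic
product of `ω^{s_T(σ)}` (the dominating coordinate) and the sum of the orders of the children,
which is replaced by `1` if there are no children. -/
def lin : SgnTree → LinOrd.{0}
  | node s [] => LinOrd.of (omegaPow s ×ₗ Unit)
  | node s (t :: ts) => LinOrd.of (omegaPow s ×ₗ linSum (t :: ts))

/-- The finite sum of the orders of the trees in a list, from left to right. -/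
def linSum : List SgnTree → LinOrd.{0}
  | [] => LinOrd.of Empty
  | t :: ts => LinOrd.of (lin t ⊕ₗ linSum ts)

end

/-- Replace the subtree `t` induced by the non-root vertex with address `σ` by the trees in the list
`f t`, which take the place of `t` among the children of the parent of `σ`. Nothing happens if `σ` is
the root or not a vertex. -/
def replaceAt (f : SgnTree → List SgnTree) : List ℕ → SgnTree → SgnTree
  | [], T => T
  | [k], node s ts => node s (ts.take k ++ (ts[k]?).toList.flatMap f ++ ts.drop (k + 1))
  | k :: l :: σ, node s ts => node s (ts.modify k (replaceAt f (l :: σ)))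

/-- Exude the first child `t₁` from a positive vertex with children `t₁, …, tₙ`, giving
`t₁` followed by a positive vertex with children `t₂, …, tₙ, t₁`; exude the last child `tₙ` from a
negative vertex, giving a negative vertex with children `tₙ, t₁, …, tₙ₋₁` followed by `tₙ`. -/
def exudeList : SgnTree → List SgnTree
  | node .pos ts => ts.head?.toList ++ [node .pos (ts.tail ++ ts.head?.toList)]
  | node .neg ts => [node .neg (ts.getLast?.toList ++ ts.dropLast)] ++ ts.getLast?.toList
  | node .zero ts => [node .zero ts]

/-- Replace the list of children of the root by `m` consecutive copies of it. -/
def replList (m : ℕ) : SgnTree → List SgnTree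
  | node s ts => [node s (List.replicate m ts).flatten]

/-! ### The two moves preserve 3-signed trees -/

/-- Every vertex has sign `0` if and only if it is a leaf. -/
def IsBranch (T : SgnTree) : Prop :=
  ∀ (σ : List ℕ) (t : SgnTree), T.sub σ = some t → (t.rootSign = 0 ↔ t.children = [])

theorem isBranch_node (s : SignType) (ts : List SgnTree) :
    (node s ts).IsBranch ↔ (s = 0 ↔ ts = []) ∧ ∀ t ∈ ts, t.IsBranch := by
  constructor
  · intro h
    refine ⟨h [] (node s ts) rfl, fun t ht σ t' h' => ?_⟩
    obtain ⟨k, hk⟩ := List.mem_iff_getElem?.1 ht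
    exact h (k :: σ) t' (by simp [sub, hk, h'])
  · rintro ⟨h0, h1⟩ σ t ht
    cases σ with
    | nil =>
      simp only [sub, Option.some.injEq] at ht
      subst ht
      exact h0
    | cons k σ =>
      simp only [sub, Option.bind_eq_some_iff] at ht
      obtain ⟨t', hk, ht'⟩ := ht
      exact h1 t' (List.mem_iff_getElem?.2 ⟨k, hk⟩) σ t ht'

theorem isThreeSigned_node (s : SignType) (ts : List SgnTree) :
    (node s ts).IsThreeSigned ↔ s = 0 ∧ ∀ t ∈ ts, t.IsBranch := by
  constructor
  · intro h
    refine ⟨(h [] (node s ts) rfl).2 (Or.inl rfl), fun t ht σ t' h' => ?_⟩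
    obtain ⟨k, hk⟩ := List.mem_iff_getElem?.1 ht
    simpa using h (k :: σ) t' (by simp [sub, hk, h'])
  · rintro ⟨h0, h1⟩ σ t ht
    cases σ with
    | nil =>
      simp only [sub, Option.some.injEq] at ht
      subst ht
      simpa [rootSign] using h0
    | cons k σ =>
      simp only [sub, Option.bind_eq_some_iff] at ht
      obtain ⟨t', hk, ht'⟩ := ht
      simpa using h1 t' (List.mem_iff_getElem?.2 ⟨k, hk⟩) σ t ht'

theorem replaceAt_aux (f : SgnTree → List SgnTree)
    (hf : ∀ t : SgnTree, t.IsBranch → f t ≠ [] ∧ ∀ t' ∈ f t, t'.IsBranch) :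
    ∀ (σ : List ℕ) (s : SignType) (ts : List SgnTree), (∀ t ∈ ts, t.IsBranch) →
      ∃ ts', replaceAt f σ (node s ts) = node s ts' ∧ (ts' = [] ↔ ts = []) ∧
        ∀ t ∈ ts', t.IsBranch
  | [], _, ts, h => ⟨ts, rfl, Iff.rfl, h⟩
  | [k], _, ts, h => by
    refine ⟨_, rfl, ?_, ?_⟩
    · rcases hk : ts[k]? with _ | t
      · rw [List.getElem?_eq_none_iff] at hk
        simp [List.take_of_length_le hk, List.drop_eq_nil_of_le (Nat.le_succ_of_le hk)]
      · have ht := List.mem_iff_getElem?.2 ⟨k, hk⟩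
        have h1 := (hf t (h t ht)).1
        have h2 : ts ≠ [] := List.ne_nil_of_mem ht
        simp [h1, h2]
    · intro t ht
      simp only [List.mem_append, List.mem_flatMap, Option.mem_toList] at ht
      rcases ht with (ht | ⟨t', ht', ht⟩) | ht
      · exact h t (List.mem_of_mem_take ht)
      · exact (hf t' (h t' (List.mem_iff_getElem?.2 ⟨k, ht'⟩))).2 t ht
      · exact h t (List.mem_of_mem_drop ht)
  | k :: l :: σ, _, ts, h => by
    refine ⟨_, rfl, by simp [← List.length_eq_zero_iff], ?_⟩
    intro t ht
    obtain ⟨j, hj⟩ := List.mem_iff_getElem?.1 ht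
    rw [List.getElem?_modify] at hj
    obtain ⟨⟨s', us⟩, hj1, hj2⟩ := Option.map_eq_some_iff.1 hj
    have hb := h _ (List.mem_iff_getElem?.2 ⟨j, hj1⟩)
    split_ifs at hj2
    · obtain ⟨hs, hus⟩ := (isBranch_node _ _).1 hb
      obtain ⟨us', e1, e2, e3⟩ := replaceAt_aux f hf (l :: σ) s' us hus
      rw [e1] at hj2
      rw [← hj2, isBranch_node]
      exact ⟨hs.trans e2.symm, e3⟩
    · rw [← hj2]
      exact hb

theorem IsThreeSigned.replaceAt {f : SgnTree → List SgnTree}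
    (hf : ∀ t : SgnTree, t.IsBranch → f t ≠ [] ∧ ∀ t' ∈ f t, t'.IsBranch)
    {T : SgnTree} (hT : T.IsThreeSigned) (σ : List ℕ) : (T.replaceAt f σ).IsThreeSigned := by
  obtain ⟨s, ts⟩ := T
  obtain ⟨hs, hts⟩ := (isThreeSigned_node _ _).1 hT
  obtain ⟨ts', e1, -, e3⟩ := replaceAt_aux f hf σ s ts hts
  rw [e1, isThreeSigned_node]
  exact ⟨hs, e3⟩

theorem exudeList_isBranch (t : SgnTree) (ht : t.IsBranch) :
    exudeList t ≠ [] ∧ ∀ t' ∈ exudeList t, t'.IsBranch := by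
  obtain ⟨s, ts⟩ := t
  obtain ⟨hs, hts⟩ := (isBranch_node _ _).1 ht
  cases s with
  | zero => exact ⟨by simp [exudeList], by simpa [exudeList] using ht⟩
  | pos =>
    refine ⟨by simp [exudeList], ?_⟩
    obtain _ | ⟨a, l⟩ := ts
    · simpa [exudeList] using ht
    · simp only [List.mem_cons, forall_eq_or_imp] at hts
      intro t' h'
      simp [exudeList] at h'
      rcases h' with rfl | rfl
      · exact hts.1
      · rw [isBranch_node]
        refine ⟨by simp [← SignType.zero_eq_zero], ?_⟩
        intro x hx
        simp at hx
        rcases hx with hx | rfl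
        · exact hts.2 x hx
        · exact hts.1
  | neg =>
    refine ⟨by simp [exudeList], ?_⟩
    rcases List.eq_nil_or_concat ts with rfl | ⟨l, a, rfl⟩
    · simpa [exudeList] using ht
    · intro t' h'
      simp [exudeList] at h'
      rcases h' with rfl | rfl
      · rw [isBranch_node]
        refine ⟨by simp [← SignType.zero_eq_zero], ?_⟩
        intro x hx
        apply hts
        simp at hx ⊢
        tauto
      · exact hts _ (by simp)

theorem replList_isBranch {m : ℕ} (hm : 1 ≤ m) (t : SgnTree) (ht : t.IsBranch) :
    replList m t ≠ [] ∧ ∀ t' ∈ replList m t, t'.IsBranch := by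
  obtain ⟨s, ts⟩ := t
  obtain ⟨hs, hts⟩ := (isBranch_node _ _).1 ht
  refine ⟨by simp [replList], ?_⟩
  simp only [replList, List.mem_singleton, forall_eq, isBranch_node]
  have hm0 : m ≠ 0 := by omega
  refine ⟨by rw [hs]; simp [List.flatten_eq_nil_iff, hm0], fun t h => ?_⟩
  obtain ⟨l, hl, ht'⟩ := List.mem_flatten.1 h
  rw [List.eq_of_mem_replicate hl] at ht'
  exact hts t ht'

end SgnTree

/-- 3-signed trees. -/
def ThreeSignedTree : Type := {T : SgnTree // T.IsThreeSigned}

namespace ThreeSignedTree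

/-- The linear order `LIN(T, s_T)`; it is `0` for the tree with one vertex. -/
def LIN (T : ThreeSignedTree) : LinOrd.{0} :=
  match T.1 with
  | .node _ [] => LinOrd.of Empty
  | .node s (t :: ts) => SgnTree.lin (.node s (t :: ts))

/-- `σ` is (the address of) a vertex of `T` with nonzero sign. -/
def SignNeZero (T : ThreeSignedTree) (σ : List ℕ) : Prop :=
  ∃ t : SgnTree, T.1.sub σ = some t ∧ t.rootSign ≠ 0

/-- `EXUDE((T, s_T); σ)`, meant for a vertex `σ` of nonzero sign. -/
def exude (T : ThreeSignedTree) (σ : List ℕ) : ThreeSignedTree :=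
  ⟨T.1.replaceAt SgnTree.exudeList σ, T.2.replaceAt SgnTree.exudeList_isBranch σ⟩

/-- `m`-`REPL((T, s_T); σ)` for `m ≥ 1`, meant for a vertex `σ` of nonzero sign. -/
def repl (T : ThreeSignedTree) (m : ℕ) (hm : 1 ≤ m) (σ : List ℕ) : ThreeSignedTree :=
  ⟨T.1.replaceAt (SgnTree.replList m) σ, T.2.replaceAt (SgnTree.replList_isBranch hm) σ⟩

/-- A basic L-equivalence. -/
inductive LStep : ThreeSignedTree → ThreeSignedTree → Prop
  | exude (T : ThreeSignedTree) (σ : List ℕ) (hσ : T.SignNeZero σ) : LStep T (T.exude σ)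
  | repl (T : ThreeSignedTree) (σ : List ℕ) (hσ : T.SignNeZero σ) (m : ℕ) (hm : 1 ≤ m) :
      LStep T (T.repl m hm σ)

/-- L-equivalence: the equivalence relation generated by the basic L-equivalences. -/
def LEquiv : ThreeSignedTree → ThreeSignedTree → Prop :=
  Relation.EqvGen LStep

end ThreeSignedTree

/-- The finitely presented linear orders: the smallest class of linear orders that is closed under
isomorphism, contains `0` and `1`, and is closed under `+`, `ω × -` and `ω^* × -`. -/
inductive IsFinitelyPresented : (L : Type u) → [LinearOrder L] → Prop
  | iso {L L' : Type u} [LinearOrder L] [LinearOrder L'] (e : L ≃o L')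
      (h : IsFinitelyPresented L) : IsFinitelyPresented L'
  | zero : IsFinitelyPresented PEmpty.{u + 1}
  | one : IsFinitelyPresented PUnit.{u + 1}
  | add {L₁ L₂ : Type u} [LinearOrder L₁] [LinearOrder L₂] (h₁ : IsFinitelyPresented L₁)
      (h₂ : IsFinitelyPresented L₂) : IsFinitelyPresented (L₁ ⊕ₗ L₂)
  | omega_mul {L : Type u} [LinearOrder L] (h : IsFinitelyPresented L) :
      IsFinitelyPresented (ℕ ×ₗ L)
  | omega_star_mul {L : Type u} [LinearOrder L] (h : IsFinitelyPresented L) :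
      IsFinitelyPresented (ℕᵒᵈ ×ₗ L)

/-!
A 3-signed tree is treated as the forest of its child subtrees, that is, as a term built from a
single letter by concatenation and the two powers `w ↦ w^ω` and `w ↦ w^ω*`. In this notation the
moves are the identities `(ab)^ω = a (ba)^ω` and `(w^m)^ω = w^ω` and their mirror images. The claim
is that these identities axiomatize isomorphism of the linear orders denoted by forests.

Soundness is a computation with `ω`-sums. The identities also preserve the height of a forest
(`ForestEquiv.rankLE_iff`).

Completeness (`RankLE.isDetermined`) says that `|F| ≅ |G|` implies `F ≈ G`. It is proved by
induction on the height of `F`. The main tool is that cuts can be followed in the syntax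
(`RankLE.hasFiniteCutTypes`): every cut of `|F|` is presented by forests `p`, `q` with `p q ≈ F`,
and the cuts fall into finitely many types such that `p q' ≈ F` even if `p` and `q'` come from
different cuts of the same type. The reason is that a cut of `w^ω` with non-empty upper part has the
form `(w^k p, q w^ω)` for a cut `(p, q)` of `w`, and `k` occurs on one side only and is absorbed when
the sides are put together.

Cutting `G` reduces completeness to a single tree `F`, by mirror symmetry to `F = w^ω`, where `w`
may be taken to have exact height `n`.
* If `G` ends with `z^ω`, say `G = G' z^ω`, the infinitely many cuts after `G' z^j` are cuts of
  `w^ω`. Two of them have the same type. The segments below the first cut and between the two cuts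
  are presented by forests of height at most `n`, to which the induction hypothesis applies; the
  identities then give `G' z^ω ≈ w^ω` (`forestEquiv_of_isCopy_pos`).
* `G` cannot end with a leaf or with `z^ω*`. Otherwise a non-empty final segment of `w^ω` would have
  a presentation of height at most `n`. By the induction hypothesis that presentation would be
  L-equivalent to some `q w^ω`, which has height `n + 1` (`not_isCopy_final_segment`).
-/

namespace SgnTree

/-! ### L-equivalence of forests -/

/-- A basic L-equivalence applied at some vertex of a forest, that is, of the list of the child
subtrees of the root. The root has sign `0`, so no move is ever applied there. -/
inductive ForestStep : List SgnTree → List SgnTree → Prop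
  | exude (A B : List SgnTree) (t : SgnTree) (ht : t.rootSign ≠ 0) :
      ForestStep (A ++ t :: B) (A ++ exudeList t ++ B)
  | repl (A B : List SgnTree) (t : SgnTree) (ht : t.rootSign ≠ 0) (m : ℕ) (hm : 1 ≤ m) :
      ForestStep (A ++ t :: B) (A ++ replList m t ++ B)
  | node (A B : List SgnTree) (s : SignType) {ts ts' : List SgnTree} (h : ForestStep ts ts') :
      ForestStep (A ++ node s ts :: B) (A ++ node s ts' :: B)

/-- L-equivalence of forests: the equivalence relation generated by the basic moves. -/
def ForestEquiv : List SgnTree → List SgnTree → Prop :=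
  Relation.EqvGen ForestStep

local infix:50 " ≈ₗ " => ForestEquiv

namespace ForestEquiv

theorem refl (F : List SgnTree) : F ≈ₗ F := Relation.EqvGen.refl F

theorem symm {F G : List SgnTree} (h : F ≈ₗ G) : G ≈ₗ F := Relation.EqvGen.symm _ _ h

theorem trans {F G H : List SgnTree} (h : F ≈ₗ G) (h' : G ≈ₗ H) : F ≈ₗ H :=
  Relation.EqvGen.trans _ _ _ h h'

instance : Trans ForestEquiv ForestEquiv ForestEquiv := ⟨trans⟩

/-- A map of forests that sends moves to moves respects L-equivalence. -/
theorem map {φ : List SgnTree → List SgnTree}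
    (hφ : ∀ F G, ForestStep F G → ForestStep (φ F) (φ G)) {F G : List SgnTree} (h : F ≈ₗ G) :
    φ F ≈ₗ φ G := by
  induction h with
  | rel F G h => exact .rel _ _ (hφ F G h)
  | refl F => exact refl _
  | symm F G _ ih => exact ih.symm
  | trans F G H _ _ ih ih' => exact ih.trans ih'

end ForestEquiv

theorem ForestStep.context {F G : List SgnTree} (h : ForestStep F G) (A B : List SgnTree) :
    ForestStep (A ++ F ++ B) (A ++ G ++ B) := by
  cases h with
  | exude A' B' t ht => simpa using ForestStep.exude (A ++ A') (B' ++ B) t ht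
  | repl A' B' t ht m hm => simpa using ForestStep.repl (A ++ A') (B' ++ B) t ht m hm
  | node A' B' s h => simpa using ForestStep.node (A ++ A') (B' ++ B) s h

namespace ForestEquiv

theorem append_left (A : List SgnTree) {F G : List SgnTree} (h : F ≈ₗ G) : A ++ F ≈ₗ A ++ G :=
  h.map fun F G h => by simpa using h.context A []

theorem append_right {F G : List SgnTree} (h : F ≈ₗ G) (B : List SgnTree) : F ++ B ≈ₗ G ++ B :=
  h.map (φ := (· ++ B)) fun F G h => by simpa using h.context [] B

theorem append {F F' G G' : List SgnTree} (h : F ≈ₗ F') (h' : G ≈ₗ G') : F ++ G ≈ₗ F' ++ G' :=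
  (h.append_right G).trans (h'.append_left F')

theorem node (s : SignType) {F G : List SgnTree} (h : F ≈ₗ G) :
    [SgnTree.node s F] ≈ₗ [SgnTree.node s G] :=
  h.map (φ := fun F => [SgnTree.node s F]) fun _ _ h => .node [] [] s h

theorem exude {t : SgnTree} (ht : t.rootSign ≠ 0) : [t] ≈ₗ exudeList t := by
  refine .rel _ _ ?_
  simpa using ForestStep.exude [] [] t ht

theorem repl {t : SgnTree} (ht : t.rootSign ≠ 0) {m : ℕ} (hm : 1 ≤ m) : [t] ≈ₗ replList m t := by
  refine .rel _ _ ?_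
  simpa using ForestStep.repl [] [] t ht m hm

end ForestEquiv

/-- The forest `w^k`: the concatenation of `k` copies of `w`. -/
def listPow (w : List SgnTree) (k : ℕ) : List SgnTree :=
  (List.replicate k w).flatten

@[simp] theorem listPow_zero (w : List SgnTree) : listPow w 0 = [] := rfl

theorem listPow_succ (w : List SgnTree) (k : ℕ) : listPow w (k + 1) = w ++ listPow w k := rfl

theorem listPow_succ' (w : List SgnTree) (k : ℕ) : listPow w (k + 1) = listPow w k ++ w := by
  induction k with
  | zero => simp [listPow_succ]
  | succ k ih =>
    rw [listPow_succ, ih, ← List.append_assoc, ← listPow_succ, ih]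

@[simp] theorem listPow_eq_nil {w : List SgnTree} {k : ℕ} :
    listPow w k = [] ↔ k = 0 ∨ w = [] := by
  induction k with
  | zero => simp
  | succ k ih => simp [listPow_succ, ih]; tauto

namespace ForestEquiv

/-- Repeated exudation: `(AB)^ω ≈ A (BA)^ω`. -/
theorem rotate (A B : List SgnTree) :
    [SgnTree.node .pos (A ++ B)] ≈ₗ A ++ [SgnTree.node .pos (B ++ A)] := by
  induction A generalizing B with
  | nil => simpa using refl _
  | cons a A ih =>
    have h1 : [SgnTree.node .pos (a :: A ++ B)] ≈ₗ
        [a] ++ [SgnTree.node .pos (A ++ (B ++ [a]))] := by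
      simpa [exudeList] using exude (t := SgnTree.node .pos (a :: A ++ B)) (by simp [rootSign])
    simpa using h1.trans ((ih (B ++ [a])).append_left [a])

/-- `w w^ω ≈ w^ω`. -/
theorem absorb (w : List SgnTree) : w ++ [SgnTree.node .pos w] ≈ₗ [SgnTree.node .pos w] := by
  simpa using (rotate w []).symm

theorem listPow_absorb (w : List SgnTree) (k : ℕ) :
    listPow w k ++ [SgnTree.node .pos w] ≈ₗ [SgnTree.node .pos w] := by
  induction k with
  | zero => simpa using refl _
  | succ k ih =>
    rw [listPow_succ', List.append_assoc]
    exact ((absorb w).append_left _).trans ih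

theorem node_listPow (w : List SgnTree) {k : ℕ} (hk : 1 ≤ k) :
    [SgnTree.node .pos w] ≈ₗ [SgnTree.node .pos (listPow w k)] :=
  repl (t := SgnTree.node .pos w) (by simp [rootSign]) hk

end ForestEquiv

/-! ### Height -/

/-- All trees of the forest have height at most `n`, and every vertex has sign `0` if and only if
it is a leaf. -/
def RankLE : ℕ → List SgnTree → Prop
  | 0, F => ∀ t ∈ F, t = node 0 []
  | n + 1, F => ∀ t ∈ F, t = node 0 [] ∨ t.rootSign ≠ 0 ∧ t.children ≠ [] ∧ RankLE n t.children

@[simp] theorem rankLE_nil (n : ℕ) : RankLE n [] := by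
  cases n <;> simp [RankLE]

theorem rankLE_iff_forall {n : ℕ} {F : List SgnTree} : RankLE n F ↔ ∀ t ∈ F, RankLE n [t] := by
  cases n <;> simp [RankLE]

theorem rankLE_append {n : ℕ} {F G : List SgnTree} :
    RankLE n (F ++ G) ↔ RankLE n F ∧ RankLE n G := by
  rw [rankLE_iff_forall, rankLE_iff_forall (F := F), rankLE_iff_forall (F := G)]
  simp only [List.mem_append, or_imp, forall_and]

theorem rankLE_cons {n : ℕ} {t : SgnTree} {F : List SgnTree} :
    RankLE n (t :: F) ↔ RankLE n [t] ∧ RankLE n F :=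
  rankLE_append (F := [t])

@[simp] theorem rankLE_leaf (n : ℕ) : RankLE n [node 0 []] := by
  cases n <;> simp [RankLE]

theorem rankLE_zero_node {s : SignType} {ts : List SgnTree} :
    RankLE 0 [node s ts] ↔ s = 0 ∧ ts = [] := by
  simp [RankLE]

theorem rankLE_succ_node {n : ℕ} {s : SignType} {ts : List SgnTree} (hs : s ≠ 0) :
    RankLE (n + 1) [node s ts] ↔ ts ≠ [] ∧ RankLE n ts := by
  simp [RankLE, hs, rootSign, children]

theorem RankLE.succ {n : ℕ} {F : List SgnTree} (h : RankLE n F) : RankLE (n + 1) F := by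
  induction n generalizing F with
  | zero => exact fun t ht => Or.inl (h t ht)
  | succ n ih => exact fun t ht => (h t ht).imp_right fun h' => ⟨h'.1, h'.2.1, ih h'.2.2⟩

theorem RankLE.mono {n m : ℕ} (hnm : n ≤ m) {F : List SgnTree} (h : RankLE n F) : RankLE m F := by
  induction hnm with
  | refl => exact h
  | step _ ih => exact ih.succ

theorem RankLE.listPow {n : ℕ} {w : List SgnTree} (h : RankLE n w) (k : ℕ) :
    RankLE n (listPow w k) := by
  induction k with
  | zero => simp
  | succ k ih => exact rankLE_append.2 ⟨h, ih⟩

theorem RankLE.exists_of_node {n : ℕ} {s : SignType} (hs : s ≠ 0) {ts : List SgnTree}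
    (h : RankLE n [SgnTree.node s ts]) : ∃ m, n = m + 1 ∧ ts ≠ [] ∧ RankLE m ts := by
  cases n with
  | zero => exact absurd (rankLE_zero_node.1 h).1 hs
  | succ n => exact ⟨n, rfl, (rankLE_succ_node hs).1 h⟩

theorem rankLE_exudeList {n : ℕ} (t : SgnTree) : RankLE n (exudeList t) ↔ RankLE n [t] := by
  obtain ⟨s, ts⟩ := t
  have hpos : SignType.pos ≠ 0 := by decide
  have hneg : SignType.neg ≠ 0 := by decide
  cases s with
  | zero => simp [exudeList]
  | pos =>
    obtain _ | ⟨a, l⟩ := ts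
    · simp [exudeList]
    · change RankLE n ([a] ++ [node .pos (l ++ [a])]) ↔ RankLE n [node .pos ([a] ++ l)]
      cases n with
      | zero => rw [rankLE_append]; simp [rankLE_zero_node]
      | succ n =>
        have := @RankLE.succ n [a]
        simp only [rankLE_append, rankLE_succ_node hpos]
        simp
        tauto
  | neg =>
    rcases List.eq_nil_or_concat ts with rfl | ⟨l, a, rfl⟩
    · simp [exudeList]
    · have h : exudeList (node .neg (l.concat a)) = [node .neg ([a] ++ l)] ++ [a] := by
        simp [exudeList]
      rw [h, List.concat_eq_append]
      cases n with
      | zero => rw [rankLE_append]; simp [rankLE_zero_node]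
      | succ n =>
        have := @RankLE.succ n [a]
        simp only [rankLE_append, rankLE_succ_node hneg]
        simp
        tauto

theorem rankLE_replList {n m : ℕ} (hm : 1 ≤ m) (t : SgnTree) (ht : t.rootSign ≠ 0) :
    RankLE n (replList m t) ↔ RankLE n [t] := by
  obtain ⟨s, ts⟩ := t
  obtain ⟨m, rfl⟩ := Nat.exists_eq_add_of_le' hm
  change RankLE n [node s (listPow ts (m + 1))] ↔ _
  cases n with
  | zero => simp [rankLE_zero_node]
  | succ n =>
    have hs : s ≠ 0 := ht
    rw [rankLE_succ_node hs, rankLE_succ_node hs]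
    simp only [ne_eq, listPow_eq_nil, Nat.add_eq_zero_iff, one_ne_zero, and_false, false_or]
    exact and_congr_right fun _ => ⟨fun h => (rankLE_append.1 h).1, fun h => h.listPow _⟩

theorem exudeList_ne_nil (t : SgnTree) : exudeList t ≠ [] := by
  obtain ⟨s, ts⟩ := t
  cases s <;> simp [exudeList]

theorem ForestStep.ne_nil {F G : List SgnTree} (h : ForestStep F G) : F ≠ [] ∧ G ≠ [] := by
  cases h with
  | exude A B t ht => simp [exudeList_ne_nil]
  | repl A B t ht m hm => obtain ⟨s, ts⟩ := t; simp [replList]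
  | node A B s h => simp

theorem ForestStep.rankLE_iff {F G : List SgnTree} (h : ForestStep F G) (n : ℕ) :
    RankLE n F ↔ RankLE n G := by
  induction h generalizing n with
  | exude A B t ht =>
    rw [List.append_cons]
    simp only [rankLE_append, rankLE_exudeList]
  | repl A B t ht m hm =>
    rw [List.append_cons]
    simp only [rankLE_append, rankLE_replList hm t ht]
  | @node A B s ts ts' h ih =>
    have : RankLE n [SgnTree.node s ts] ↔ RankLE n [SgnTree.node s ts'] := by
      cases n with
      | zero => simp [rankLE_zero_node, h.ne_nil]
      | succ n => simp [RankLE, rootSign, children, ih n, h.ne_nil]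
    rw [List.append_cons A (SgnTree.node s ts), List.append_cons A (SgnTree.node s ts')]
    simp only [rankLE_append, this]

/-- The moves change neither the height nor the property that exactly the leaves have sign `0`. -/
theorem ForestEquiv.rankLE_iff {F G : List SgnTree} (h : F ≈ₗ G) (n : ℕ) :
    RankLE n F ↔ RankLE n G := by
  induction h with
  | rel F G h => exact h.rankLE_iff n
  | refl F => exact Iff.rfl
  | symm F G _ ih => exact ih.symm
  | trans F G H _ _ ih ih' => exact ih.trans ih'

theorem exists_rankLE_of_forall {F : List SgnTree} (h : ∀ t ∈ F, ∃ n, RankLE n [t]) :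
    ∃ n, RankLE n F := by
  induction F with
  | nil => exact ⟨0, by simp⟩
  | cons t F ih =>
    obtain ⟨n, hn⟩ := h t (by simp)
    obtain ⟨m, hm⟩ := ih fun t' ht' => h t' (by simp [ht'])
    exact ⟨max n m, rankLE_cons.2 ⟨hn.mono (le_max_left _ _), hm.mono (le_max_right _ _)⟩⟩

/-- Together with `RankLE.isBranch`, this identifies the forests of some height `RankLE n` with the
forests of subtrees of 3-signed trees. -/
theorem IsBranch.exists_rankLE : ∀ t : SgnTree, t.IsBranch → ∃ n, RankLE n [t]
  | node s ts, h => by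
    obtain ⟨hs, hts⟩ := (isBranch_node s ts).1 h
    obtain ⟨n, hn⟩ := exists_rankLE_of_forall fun t ht => IsBranch.exists_rankLE t (hts t ht)
    by_cases h0 : s = 0
    · obtain rfl := hs.1 h0
      subst h0
      exact ⟨0, by simp⟩
    · exact ⟨n + 1, (rankLE_succ_node h0).2 ⟨fun h' => h0 (hs.2 h'), hn⟩⟩

theorem RankLE.isBranch {n : ℕ} {F : List SgnTree} (h : RankLE n F) : ∀ t ∈ F, t.IsBranch := by
  induction n generalizing F with
  | zero =>
    intro t ht
    rw [h t ht, isBranch_node]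
    simp
  | succ n ih =>
    intro t ht
    rcases h t ht with rfl | ⟨h0, h1, h2⟩
    · rw [isBranch_node]
      simp
    · obtain ⟨s, ts⟩ := t
      rw [isBranch_node]
      exact ⟨iff_of_false h0 h1, ih h2⟩

/-! ### Reversal -/

mutual

/-- The mirror image of a tree: all signs are negated and all lists of children are reversed. -/
def reverse : SgnTree → SgnTree
  | node s ts => node (-s) (reverseList ts)

/-- The mirror image of a forest. -/
def reverseList : List SgnTree → List SgnTree
  | [] => []
  | t :: ts => reverseList ts ++ [reverse t]

end

@[simp] theorem reverse_node (s : SignType) (ts : List SgnTree) :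
    reverse (node s ts) = node (-s) (reverseList ts) := rfl

@[simp] theorem reverseList_nil : reverseList [] = [] := rfl

theorem reverseList_cons (t : SgnTree) (ts : List SgnTree) :
    reverseList (t :: ts) = reverseList ts ++ [reverse t] := rfl

@[simp] theorem reverseList_singleton (t : SgnTree) : reverseList [t] = [reverse t] := rfl

@[simp] theorem reverseList_append (F G : List SgnTree) :
    reverseList (F ++ G) = reverseList G ++ reverseList F := by
  induction F with
  | nil => simp
  | cons t F ih => simp [reverseList_cons, ih]

@[simp] theorem reverseList_eq_nil {F : List SgnTree} : reverseList F = [] ↔ F = [] := by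
  cases F <;> simp [reverseList_cons]

mutual

theorem reverse_reverse : ∀ t : SgnTree, reverse (reverse t) = t
  | node s ts => by simp [reverseList_reverseList ts]

@[simp] theorem reverseList_reverseList : ∀ F : List SgnTree, reverseList (reverseList F) = F
  | [] => rfl
  | t :: F => by simp [reverseList_cons, reverse_reverse t, reverseList_reverseList F]

end

theorem reverseList_listPow (w : List SgnTree) (k : ℕ) :
    reverseList (listPow w k) = listPow (reverseList w) k := by
  induction k with
  | zero => rfl
  | succ k ih => rw [listPow_succ, reverseList_append, ih, listPow_succ']

theorem exudeList_reverse (t : SgnTree) : exudeList (reverse t) = reverseList (exudeList t) := by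
  obtain ⟨s, ts⟩ := t
  cases s with
  | zero => rfl
  | pos =>
    cases ts with
    | nil => rfl
    | cons a l =>
      simp [exudeList, reverseList_cons]
  | neg =>
    rcases List.eq_nil_or_concat ts with rfl | ⟨l, a, rfl⟩
    · rfl
    · simp [exudeList, reverseList_cons]

theorem replList_reverse (m : ℕ) (t : SgnTree) :
    replList m (reverse t) = reverseList (replList m t) := by
  obtain ⟨s, ts⟩ := t
  change [node (-s) (listPow (reverseList ts) m)] = [reverse (node s (listPow ts m))]
  rw [reverse_node, reverseList_listPow]

theorem ForestStep.reverse {F G : List SgnTree} (h : ForestStep F G) :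
    ForestStep (reverseList F) (reverseList G) := by
  induction h with
  | exude A B t ht =>
    have := ForestStep.exude (reverseList B) (reverseList A) (SgnTree.reverse t)
      (by cases t; simpa [rootSign] using ht)
    simpa [reverseList_cons, exudeList_reverse] using this
  | repl A B t ht m hm =>
    have := ForestStep.repl (reverseList B) (reverseList A) (SgnTree.reverse t)
      (by cases t; simpa [rootSign] using ht) m hm
    simpa [reverseList_cons, replList_reverse] using this
  | node A B s h ih =>
    simpa [reverseList_cons] using ForestStep.node (reverseList B) (reverseList A) (-s) ih

theorem ForestEquiv.reverse {F G : List SgnTree} (h : F ≈ₗ G) : reverseList F ≈ₗ reverseList G :=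
  h.map fun _ _ h => h.reverse

theorem RankLE.reverse {n : ℕ} {F : List SgnTree} (h : RankLE n F) : RankLE n (reverseList F) := by
  induction n generalizing F with
  | zero =>
    induction F with
    | nil => simp
    | cons t F ih =>
      obtain ⟨h1, h2⟩ := rankLE_cons.1 h
      refine rankLE_append.2 ⟨ih h2, ?_⟩
      rw [h1 t (by simp)]
      simp
  | succ n ihn =>
    induction F with
    | nil => simp
    | cons t F ih =>
      obtain ⟨h1, h2⟩ := rankLE_cons.1 h
      refine rankLE_append.2 ⟨ih h2, ?_⟩
      rcases h1 t (by simp) with rfl | ⟨h3, h4, h5⟩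
      · simp
      · obtain ⟨s, ts⟩ := t
        rw [reverse_node, rankLE_succ_node (by simpa [rootSign] using h3)]
        exact ⟨by simpa [children] using h4, ihn h5⟩

/-! ### Copies of a linear order inside another one -/

/-- Every element of `S` is smaller than every element of `T`. -/
def Before {X : Type*} [LinearOrder X] (S T : Set X) : Prop :=
  ∀ a ∈ S, ∀ b ∈ T, a < b

/-- The subset `S` of `X`, with the induced order, is isomorphic to `A`. -/
def Copy (A : Type*) [LinearOrder A] {X : Type*} [LinearOrder X] (S : Set X) : Prop :=
  ∃ f : A ↪o X, Set.range f = S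

section Copy

variable {A B X : Type*} [LinearOrder A] [LinearOrder B] [LinearOrder X] {S : Set X}

theorem Copy.congr (h : Copy A S) (e : A ≃o B) : Copy B S := by
  obtain ⟨f, rfl⟩ := h
  exact ⟨e.symm.toOrderEmbedding.trans f, by
    ext x
    simp only [Set.mem_range]
    exact ⟨fun ⟨b, hb⟩ => ⟨e.symm b, hb⟩, fun ⟨a, ha⟩ => ⟨e a, by simpa using ha⟩⟩⟩

theorem Copy.nonempty_orderIso (h : Copy A S) (h' : Copy B S) : Nonempty (A ≃o B) := by
  obtain ⟨f, hf⟩ := h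
  obtain ⟨g, rfl⟩ := h'
  exact ⟨(f.orderIso.trans (OrderIso.setCongr _ _ hf)).trans g.orderIso.symm⟩

theorem copy_univ (A : Type*) [LinearOrder A] : Copy A (Set.univ : Set A) :=
  ⟨(OrderIso.refl A).toOrderEmbedding, Set.range_id⟩

theorem Copy.image {Y : Type*} [LinearOrder Y] (h : Copy A S) (g : X ↪o Y) : Copy A (g '' S) := by
  obtain ⟨f, rfl⟩ := h
  exact ⟨f.trans g, Set.range_comp g f⟩

theorem copy_of_isEmpty [IsEmpty A] : Copy A S ↔ S = ∅ := by
  constructor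
  · rintro ⟨f, rfl⟩
    exact Set.range_eq_empty f
  · rintro rfl
    exact ⟨OrderEmbedding.ofIsEmpty, Set.range_eq_empty _⟩

theorem copy_unit : Copy Unit S ↔ ∃ x, S = {x} := by
  constructor
  · rintro ⟨f, rfl⟩
    exact ⟨f (), Set.range_unique⟩
  · rintro ⟨x, rfl⟩
    exact ⟨OrderEmbedding.ofStrictMono (fun _ => x) (fun a b h => (lt_irrefl _ h).elim),
      Set.range_const⟩

theorem copy_sum : Copy (A ⊕ₗ B) S ↔
    ∃ S₁ S₂, Before S₁ S₂ ∧ S = S₁ ∪ S₂ ∧ Copy A S₁ ∧ Copy B S₂ := by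
  constructor
  · rintro ⟨f, rfl⟩
    refine ⟨Set.range fun a => f (toLex (Sum.inl a)), Set.range fun b => f (toLex (Sum.inr b)),
      ?_, ?_, ⟨OrderEmbedding.ofStrictMono _ ?_, rfl⟩, ⟨OrderEmbedding.ofStrictMono _ ?_, rfl⟩⟩
    · rintro _ ⟨a, rfl⟩ _ ⟨b, rfl⟩
      exact f.strictMono (Sum.Lex.inl_lt_inr a b)
    · ext x
      constructor
      · rintro ⟨c, rfl⟩
        rcases c with a | b
        · exact Or.inl ⟨a, rfl⟩
        · exact Or.inr ⟨b, rfl⟩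
      · rintro (⟨a, rfl⟩ | ⟨b, rfl⟩)
        · exact ⟨_, rfl⟩
        · exact ⟨_, rfl⟩
    · exact fun a b h => f.strictMono (Sum.Lex.inl_lt_inl_iff.2 h)
    · exact fun a b h => f.strictMono (Sum.Lex.inr_lt_inr_iff.2 h)
  · rintro ⟨_, _, hb, rfl, ⟨f, rfl⟩, ⟨g, rfl⟩⟩
    refine ⟨OrderEmbedding.ofStrictMono (fun c => Sum.elim f g (ofLex c)) ?_, ?_⟩
    · rintro (a | a) (b | b) h
      · exact f.strictMono (Sum.Lex.inl_lt_inl_iff.1 h)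
      · exact hb _ ⟨a, rfl⟩ _ ⟨b, rfl⟩
      · exact (Sum.Lex.not_inr_lt_inl h).elim
      · exact g.strictMono (Sum.Lex.inr_lt_inr_iff.1 h)
    · exact Set.Sum.elim_range f g

theorem copy_lex_prod {I : Type*} [LinearOrder I] : Copy (I ×ₗ A) S ↔
    ∃ T : I → Set X, (∀ i j, i < j → Before (T i) (T j)) ∧ S = ⋃ i, T i ∧ ∀ i, Copy A (T i) := by
  constructor
  · rintro ⟨f, rfl⟩
    refine ⟨fun i => Set.range fun a => f (toLex (i, a)), ?_, ?_,
      fun i => ⟨OrderEmbedding.ofStrictMono _ ?_, rfl⟩⟩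
    · rintro i j hij _ ⟨a, rfl⟩ _ ⟨b, rfl⟩
      exact f.strictMono (Prod.Lex.toLex_lt_toLex.2 (Or.inl hij))
    · ext x
      simp only [Set.mem_range, Set.mem_iUnion]
      exact ⟨fun ⟨c, hc⟩ => ⟨(ofLex c).1, (ofLex c).2, hc⟩, fun ⟨i, a, ha⟩ => ⟨_, ha⟩⟩
    · exact fun a b h => f.strictMono (Prod.Lex.toLex_lt_toLex.2 (Or.inr ⟨rfl, h⟩))
  · rintro ⟨T, hT, rfl, hc⟩
    choose f hf using hc
    refine ⟨OrderEmbedding.ofStrictMono (fun c => f (ofLex c).1 (ofLex c).2) ?_, ?_⟩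
    · intro c d h
      obtain ⟨⟨i, a⟩, rfl⟩ := toLex.surjective c
      obtain ⟨⟨j, b⟩, rfl⟩ := toLex.surjective d
      rcases Prod.Lex.toLex_lt_toLex.1 h with h | ⟨h, h'⟩
      · exact hT _ _ h _ (hf i ▸ Set.mem_range_self a) _ (hf j ▸ Set.mem_range_self b)
      · obtain rfl : i = j := h
        exact (f i).strictMono h'
    · ext x
      simp only [← hf, Set.mem_iUnion, Set.mem_range]
      exact ⟨fun ⟨c, hc⟩ => ⟨(ofLex c).1, (ofLex c).2, hc⟩, fun ⟨i, a, ha⟩ => ⟨toLex (i, a), ha⟩⟩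

end Copy

/-- The subset `S` of `X` is isomorphic to the linear order of the forest `F`. -/
def IsCopy (F : List SgnTree) {X : Type*} [LinearOrder X] (S : Set X) : Prop :=
  Copy (linSum F) S

section IsCopy

variable {X : Type*} [LinearOrder X] {S : Set X}

@[simp] theorem isCopy_nil : IsCopy [] S ↔ S = ∅ :=
  copy_of_isEmpty (A := Empty)

theorem isCopy_singleton {t : SgnTree} : IsCopy [t] S ↔ Copy (lin t) S := by
  refine (copy_sum (A := lin t) (B := Empty)).trans ?_
  simp only [copy_of_isEmpty]
  constructor
  · rintro ⟨S₁, _, -, rfl, h, rfl⟩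
    simpa using h
  · exact fun h => ⟨S, ∅, by simp [Before], by simp, h, rfl⟩

theorem isCopy_cons {t : SgnTree} {F : List SgnTree} : IsCopy (t :: F) S ↔
    ∃ S₁ S₂, Before S₁ S₂ ∧ S = S₁ ∪ S₂ ∧ IsCopy [t] S₁ ∧ IsCopy F S₂ := by
  simp only [isCopy_singleton]
  exact copy_sum (A := lin t) (B := linSum F)

theorem Before.union_left {S₁ S₂ T : Set X} (h₁ : Before S₁ T) (h₂ : Before S₂ T) :
    Before (S₁ ∪ S₂) T := by
  rintro a (ha | ha)
  exacts [h₁ a ha, h₂ a ha]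

theorem Before.union_right {S T₁ T₂ : Set X} (h₁ : Before S T₁) (h₂ : Before S T₂) :
    Before S (T₁ ∪ T₂) := by
  rintro a ha b (hb | hb)
  exacts [h₁ a ha b hb, h₂ a ha b hb]

theorem Before.mono {S S' T T' : Set X} (h : Before S T) (hS : S' ⊆ S) (hT : T' ⊆ T) :
    Before S' T' :=
  fun a ha b hb => h a (hS ha) b (hT hb)

theorem isCopy_append {F G : List SgnTree} : IsCopy (F ++ G) S ↔
    ∃ S₁ S₂, Before S₁ S₂ ∧ S = S₁ ∪ S₂ ∧ IsCopy F S₁ ∧ IsCopy G S₂ := by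
  induction F generalizing S with
  | nil =>
    constructor
    · exact fun h => ⟨∅, S, by simp [Before], by simp, by simp, h⟩
    · rintro ⟨S₁, S₂, -, rfl, h, h'⟩
      rw [isCopy_nil] at h
      simpa [h] using h'
  | cons t F ih =>
    rw [List.cons_append, isCopy_cons]
    constructor
    · rintro ⟨S₁, S₂, hb, rfl, h, h'⟩
      obtain ⟨S₃, S₄, hb', rfl, h₃, h₄⟩ := ih.1 h'
      refine ⟨S₁ ∪ S₃, S₄, .union_left (hb.mono subset_rfl (by simp)) hb', by
        rw [Set.union_assoc], isCopy_cons.2 ⟨S₁, S₃, hb.mono subset_rfl (by simp), rfl, h, h₃⟩, h₄⟩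
    · rintro ⟨S₁, S₂, hb, rfl, h, h'⟩
      obtain ⟨S₃, S₄, hb', rfl, h₃, h₄⟩ := isCopy_cons.1 h
      exact ⟨S₃, S₄ ∪ S₂, .union_right hb' (hb.mono (by simp) subset_rfl), by
        rw [Set.union_assoc], h₃, ih.2 ⟨S₄, S₂, hb.mono (by simp) subset_rfl, rfl, h₄, h'⟩⟩

theorem IsCopy.append {F G : List SgnTree} {T : Set X} (h : IsCopy F S) (h' : IsCopy G T)
    (hb : Before S T) : IsCopy (F ++ G) (S ∪ T) :=
  isCopy_append.2 ⟨S, T, hb, rfl, h, h'⟩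

theorem lin_node (s : SignType) {ts : List SgnTree} (h : ts ≠ []) :
    lin (node s ts) = LinOrd.of (omegaPow s ×ₗ linSum ts) := by
  cases ts with
  | nil => exact absurd rfl h
  | cons t ts => rfl

theorem isCopy_node {s : SignType} {w : List SgnTree} (hw : w ≠ []) : IsCopy [node s w] S ↔
    ∃ T : omegaPow s → Set X,
      (∀ i j, i < j → Before (T i) (T j)) ∧ S = ⋃ i, T i ∧ ∀ i, IsCopy w (T i) := by
  rw [isCopy_singleton, lin_node s hw]
  exact copy_lex_prod

theorem isCopy_pos {w : List SgnTree} (hw : w ≠ []) : IsCopy [node .pos w] S ↔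
    ∃ T : ℕ → Set X,
      (∀ i j, i < j → Before (T i) (T j)) ∧ S = ⋃ i, T i ∧ ∀ i, IsCopy w (T i) :=
  isCopy_node hw

theorem isCopy_neg {w : List SgnTree} (hw : w ≠ []) : IsCopy [node .neg w] S ↔
    ∃ T : ℕ → Set X,
      (∀ i j, j < i → Before (T i) (T j)) ∧ S = ⋃ i, T i ∧ ∀ i, IsCopy w (T i) :=
  isCopy_node hw

theorem isCopy_leaf : IsCopy [node 0 []] S ↔ ∃ x, S = {x} := by
  rw [isCopy_singleton, ← copy_unit]
  change Copy (Unit ×ₗ Unit) S ↔ _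
  have e : Unit ×ₗ Unit ≃o Unit :=
    { toFun := fun _ => ()
      invFun := fun _ => toLex ((), ())
      left_inv := fun _ => rfl
      right_inv := fun _ => rfl
      map_rel_iff' := fun {a b} => by
        simp only [le_refl, true_iff]
        exact le_of_eq (Subsingleton.elim (α := Unit × Unit) _ _) }
  exact ⟨fun h => h.congr e, fun h => h.congr e.symm⟩

theorem IsCopy.nonempty {n : ℕ} {F : List SgnTree} (hF : RankLE n F) (h0 : F ≠ [])
    (h : IsCopy F S) : S.Nonempty := by
  induction n generalizing F S with
  | zero =>
    obtain _ | ⟨t, F⟩ := F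
    · exact absurd rfl h0
    · obtain ⟨S₁, S₂, -, rfl, h, -⟩ := isCopy_cons.1 h
      rw [hF t (by simp), isCopy_leaf] at h
      obtain ⟨x, rfl⟩ := h
      simp
  | succ n ih =>
    obtain _ | ⟨t, F⟩ := F
    · exact absurd rfl h0
    · obtain ⟨S₁, S₂, -, rfl, h, -⟩ := isCopy_cons.1 h
      refine Set.Nonempty.inl ?_
      rcases hF t (by simp) with rfl | ⟨h1, h2, h3⟩
      · obtain ⟨x, rfl⟩ := isCopy_leaf.1 h
        simp
      · obtain ⟨s, w⟩ := t
        obtain ⟨T, -, rfl, hT⟩ := (isCopy_node h2).1 h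
        cases s with
        | zero => exact absurd rfl h1
        | pos => exact (ih h3 h2 (hT (0 : ℕ))).mono (Set.subset_iUnion _ _)
        | neg => exact (ih h3 h2 (hT (OrderDual.toDual 0 : ℕᵒᵈ))).mono (Set.subset_iUnion _ _)

theorem isCopy_univ (F : List SgnTree) : IsCopy F (Set.univ : Set (linSum F)) :=
  copy_univ _

/-! ### The mirror image of a copy -/

theorem Before.dual {S T : Set X} (h : Before S T) :
    Before (OrderDual.ofDual ⁻¹' T) (OrderDual.ofDual ⁻¹' S) :=
  fun a ha b hb => h (OrderDual.ofDual b) hb (OrderDual.ofDual a) ha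

theorem IsCopy.reverse {n : ℕ} {F : List SgnTree} (hF : RankLE n F) (h : IsCopy F S) :
    IsCopy (reverseList F) (OrderDual.ofDual ⁻¹' S) := by
  induction n generalizing F S with
  | zero =>
    induction F generalizing S with
    | nil =>
      obtain rfl := isCopy_nil.1 h
      exact isCopy_nil.2 rfl
    | cons t F ih =>
      obtain ⟨h1, h2⟩ := rankLE_cons.1 hF
      obtain ⟨S₁, S₂, hb, rfl, h3, h4⟩ := isCopy_cons.1 h
      rw [h1 t (by simp)] at h3 ⊢
      obtain ⟨x, rfl⟩ := isCopy_leaf.1 h3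
      rw [Set.preimage_union, Set.union_comm]
      exact (ih h2 h4).append (isCopy_leaf.2 ⟨OrderDual.toDual x, rfl⟩) hb.dual
  | succ n ihn =>
    induction F generalizing S with
    | nil =>
      obtain rfl := isCopy_nil.1 h
      exact isCopy_nil.2 rfl
    | cons t F ih =>
      obtain ⟨h1, h2⟩ := rankLE_cons.1 hF
      obtain ⟨S₁, S₂, hb, rfl, h3, h4⟩ := isCopy_cons.1 h
      rw [Set.preimage_union, Set.union_comm]
      refine (ih h2 h4).append ?_ hb.dual
      rcases h1 t (by simp) with rfl | ⟨h5, h6, h7⟩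
      · obtain ⟨x, rfl⟩ := isCopy_leaf.1 h3
        exact isCopy_leaf.2 ⟨OrderDual.toDual x, rfl⟩
      · obtain ⟨s, w⟩ := t
        have h6' : reverseList w ≠ [] := by simpa [children] using h6
        cases s with
        | zero => exact absurd rfl h5
        | pos =>
          obtain ⟨T, hT, rfl, hc⟩ := (isCopy_pos h6).1 h3
          exact (isCopy_neg h6').2 ⟨fun i => OrderDual.ofDual ⁻¹' T i,
            fun i j hij => (hT j i hij).dual, Set.preimage_iUnion, fun i => ihn h7 (hc i)⟩
        | neg =>
          obtain ⟨T, hT, rfl, hc⟩ := (isCopy_neg h6).1 h3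
          exact (isCopy_pos h6').2 ⟨fun i => OrderDual.ofDual ⁻¹' T i,
            fun i j hij => (hT j i hij).dual, Set.preimage_iUnion, fun i => ihn h7 (hc i)⟩

theorem IsCopy.of_reverse {n : ℕ} {F : List SgnTree} (hF : RankLE n F)
    (h : IsCopy F (OrderDual.ofDual ⁻¹' S)) : IsCopy (reverseList F) S := by
  have h' := (h.reverse hF).image (OrderIso.dualDual X).symm.toOrderEmbedding
  have hS : (OrderIso.dualDual X).symm.toOrderEmbedding ''
      (OrderDual.ofDual ⁻¹' (OrderDual.ofDual ⁻¹' S)) = S := by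
    ext x
    exact ⟨by rintro ⟨y, hy, rfl⟩; exact hy, fun hx => ⟨OrderIso.dualDual X x, hx, rfl⟩⟩
  rwa [hS] at h'

/-! ### Intervals of an `ω`-sum -/

theorem Before.iUnion_left {ι : Sort*} {T : ι → Set X} (h : ∀ i, Before (T i) S) :
    Before (⋃ i, T i) S := by
  intro a ha b hb
  obtain ⟨i, hi⟩ := Set.mem_iUnion.1 ha
  exact h i a hi b hb

theorem Before.iUnion_right {ι : Sort*} {T : ι → Set X} (h : ∀ i, Before S (T i)) :
    Before S (⋃ i, T i) := by
  intro a ha b hb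
  obtain ⟨i, hi⟩ := Set.mem_iUnion.1 hb
  exact h i a ha b hi

theorem isCopy_listPow {w : List SgnTree} {T : ℕ → Set X}
    (hT : ∀ i j, i < j → Before (T i) (T j)) (hc : ∀ i, IsCopy w (T i)) (a k : ℕ) :
    IsCopy (listPow w k) (⋃ i ∈ Set.Ico a (a + k), T i) := by
  induction k with
  | zero => simp
  | succ k ih =>
    rw [listPow_succ']
    have : (⋃ i ∈ Set.Ico a (a + (k + 1)), T i) =
        (⋃ i ∈ Set.Ico a (a + k), T i) ∪ T (a + k) := by
      have : Set.Ico a (a + (k + 1)) = insert (a + k) (Set.Ico a (a + k)) := by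
        ext i
        simp only [Set.mem_Ico, Set.mem_insert_iff]
        omega
      rw [this, Set.biUnion_insert, Set.union_comm]
    rw [this]
    refine ih.append (hc _) ?_
    exact .iUnion_left fun i => .iUnion_left fun hi => hT _ _ hi.2

theorem isCopy_tail {w : List SgnTree} (hw : w ≠ []) {T : ℕ → Set X}
    (hT : ∀ i j, i < j → Before (T i) (T j)) (hc : ∀ i, IsCopy w (T i)) (a : ℕ) :
    IsCopy [node .pos w] (⋃ i ∈ Set.Ici a, T i) := by
  refine (isCopy_pos hw).2 ⟨fun i => T (a + i), fun i j hij => hT _ _ (by omega), ?_,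
    fun i => hc _⟩
  ext x
  simp only [Set.mem_iUnion, Set.mem_Ici]
  constructor
  · rintro ⟨i, hi, hx⟩
    exact ⟨i - a, by rwa [Nat.add_sub_cancel' hi]⟩
  · rintro ⟨i, hx⟩
    exact ⟨a + i, by omega, hx⟩

/-! ### The moves preserve the linear order -/

/-- If every block of an `ω`-sum is `A i` followed by `L i`, then the sum is `A 0` followed by the
`ω`-sum of the blocks `L i + A (i + 1)`. -/
theorem isCopy_exude_pos {a : SgnTree} {l : List SgnTree}
    (h : IsCopy [node .pos (a :: l)] S) : IsCopy (a :: [node .pos (l ++ [a])]) S := by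
  obtain ⟨T, hT, rfl, hc⟩ := (isCopy_pos (by simp)).1 h
  choose A L hb hAL hA hL using fun i => isCopy_cons.1 (hc i)
  have hAT : ∀ i, A i ⊆ T i := fun i => by rw [hAL i]; exact Set.subset_union_left
  have hLT : ∀ i, L i ⊆ T i := fun i => by rw [hAL i]; exact Set.subset_union_right
  have hLA : ∀ i, L i ∪ A (i + 1) ⊆ T i ∪ T (i + 1) := fun i =>
    Set.union_subset_union (hLT i) (hAT _)
  refine isCopy_cons.2 ⟨A 0, ⋃ i, (L i ∪ A (i + 1)), ?_, ?_, hA 0, (isCopy_pos (by simp)).2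
    ⟨fun i => L i ∪ A (i + 1), ?_, rfl, fun i =>
      (hL i).append (hA _) ((hT i (i + 1) (by omega)).mono (hLT _) (hAT _))⟩⟩
  · refine .iUnion_right fun i => .union_right ?_ ((hT 0 (i + 1) (by omega)).mono (hAT _) (hAT _))
    rcases Nat.eq_zero_or_pos i with rfl | hi
    · exact hb 0
    · exact (hT 0 i hi).mono (hAT _) (hLT _)
  · ext x
    simp only [hAL, Set.mem_union, Set.mem_iUnion]
    constructor
    · rintro ⟨i, hx | hx⟩
      · cases i with
        | zero => exact Or.inl hx
        | succ i => exact Or.inr ⟨i, Or.inr hx⟩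
      · exact Or.inr ⟨i, Or.inl hx⟩
    · rintro (hx | ⟨i, hx | hx⟩)
      exacts [⟨0, Or.inl hx⟩, ⟨i, Or.inr hx⟩, ⟨i + 1, Or.inl hx⟩]
  · intro i j hij
    refine .union_left (.union_right ?_ ?_) (.union_right ?_ ?_)
    · exact (hT i j hij).mono (hLT _) (hLT _)
    · exact (hT i (j + 1) (by omega)).mono (hLT _) (hAT _)
    · rcases Nat.lt_or_ge (i + 1) j with hij' | hij'
      · exact (hT _ _ hij').mono (hAT _) (hLT _)
      · obtain rfl : i + 1 = j := by omega
        exact hb _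
    · exact (hT (i + 1) (j + 1) (by omega)).mono (hAT _) (hAT _)

/-- An `ω`-sum may be regrouped into blocks of `m` consecutive summands. -/
theorem isCopy_repl_pos {w : List SgnTree} (hw : w ≠ []) {m : ℕ} (hm : 1 ≤ m)
    (h : IsCopy [node .pos w] S) : IsCopy [node .pos (listPow w m)] S := by
  obtain ⟨T, hT, rfl, hc⟩ := (isCopy_pos hw).1 h
  refine (isCopy_pos (by simp [hw]; omega)).2
    ⟨fun k => ⋃ i ∈ Set.Ico (k * m) (k * m + m), T i, ?_, ?_, fun k => isCopy_listPow hT hc _ _⟩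
  · intro k l hkl
    refine .iUnion_left fun i => .iUnion_left fun hi => .iUnion_right fun j => .iUnion_right
      fun hj => hT _ _ ?_
    have : (k + 1) * m ≤ l * m := Nat.mul_le_mul_right m hkl
    have h1 := hi.2
    have h2 := hj.1
    rw [add_mul, one_mul] at this
    omega
  · ext x
    simp only [Set.mem_iUnion, Set.mem_Ico]
    constructor
    · rintro ⟨i, hx⟩
      refine ⟨i / m, i, ⟨Nat.div_mul_le_self i m, ?_⟩, hx⟩
      exact Nat.lt_div_mul_add hm
    · rintro ⟨k, i, -, hx⟩
      exact ⟨i, hx⟩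

/-- A vertex of sign `-` is reduced to one of sign `+` by taking mirror images. -/
theorem isCopy_exudeList {n : ℕ} {t : SgnTree} (hn : RankLE n [t]) (ht : t.rootSign ≠ 0)
    (h : IsCopy [t] S) : IsCopy (exudeList t) S := by
  obtain ⟨s, ts⟩ := t
  have key : ∀ {Y : Type _} [LinearOrder Y] {S : Set Y} {ts : List SgnTree},
      IsCopy [node .pos ts] S → IsCopy (exudeList (node .pos ts)) S := by
    intro Y _ S ts h
    cases ts with
    | nil => exact h
    | cons a l => simpa [exudeList] using isCopy_exude_pos h
  cases s with
  | zero => exact absurd rfl ht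
  | pos => exact key h
  | neg =>
    have h1 := h.reverse hn
    have h2 := key (ts := reverseList ts) h1
    have h3 : exudeList (node .pos (reverseList ts)) = reverseList (exudeList (node .neg ts)) :=
      exudeList_reverse (node .neg ts)
    rw [h3] at h2
    simpa using h2.of_reverse ((rankLE_exudeList _).2 hn).reverse

theorem isCopy_replList {n m : ℕ} (hm : 1 ≤ m) {t : SgnTree} (hn : RankLE n [t])
    (ht : t.rootSign ≠ 0) (h : IsCopy [t] S) : IsCopy (replList m t) S := by
  obtain ⟨s, ts⟩ := t
  obtain ⟨-, -, h0, -⟩ := hn.exists_of_node ht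
  cases s with
  | zero => exact absurd rfl ht
  | pos => exact isCopy_repl_pos h0 hm h
  | neg =>
    have h1 := h.reverse hn
    have h2 := isCopy_repl_pos (w := reverseList ts) (by simpa using h0) hm h1
    have h3 : [node .pos (listPow (reverseList ts) m)] =
        reverseList (replList m (node .neg ts)) :=
      replList_reverse m (node .neg ts)
    rw [h3] at h2
    simpa using h2.of_reverse ((rankLE_replList hm _ ht).2 hn).reverse

theorem ForestStep.isCopy {n : ℕ} {F G : List SgnTree} (h : ForestStep F G) (hF : RankLE n F)
    (hS : IsCopy F S) : IsCopy G S := by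
  induction h generalizing n S with
  | exude A B t ht =>
    rw [List.append_cons] at hF hS
    obtain ⟨S₁, S₂, hb, rfl, h1, h2⟩ := isCopy_append.1 hS
    obtain ⟨S₃, S₄, hb', rfl, h3, h4⟩ := isCopy_append.1 h1
    rw [rankLE_append, rankLE_append] at hF
    exact (h3.append (isCopy_exudeList hF.1.2 ht h4) hb').append h2 hb
  | repl A B t ht m hm =>
    rw [List.append_cons] at hF hS
    obtain ⟨S₁, S₂, hb, rfl, h1, h2⟩ := isCopy_append.1 hS
    obtain ⟨S₃, S₄, hb', rfl, h3, h4⟩ := isCopy_append.1 h1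
    rw [rankLE_append, rankLE_append] at hF
    exact (h3.append (isCopy_replList hm hF.1.2 ht h4) hb').append h2 hb
  | @node A B s ts ts' h ih =>
    rw [List.append_cons] at hF hS ⊢
    obtain ⟨S₁, S₂, hb, rfl, h1, h2⟩ := isCopy_append.1 hS
    obtain ⟨S₃, S₄, hb', rfl, h3, h4⟩ := isCopy_append.1 h1
    rw [rankLE_append, rankLE_append] at hF
    refine (h3.append ?_ hb').append h2 hb
    obtain ⟨T, hT, rfl, hc⟩ := (isCopy_node h.ne_nil.1).1 h4
    have hn : ∃ m, RankLE m ts := by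
      cases n with
      | zero => exact absurd (rankLE_zero_node.1 hF.1.2).2 h.ne_nil.1
      | succ n =>
        rcases hF.1.2 (SgnTree.node s ts) (by simp) with h' | h'
        · exact absurd (SgnTree.node.inj h').2 h.ne_nil.1
        · exact ⟨n, h'.2.2⟩
    obtain ⟨m, hm⟩ := hn
    exact (isCopy_node h.ne_nil.2).2 ⟨T, hT, rfl, fun i => ih hm (hc i)⟩

end IsCopy

theorem ForestStep.nonempty_orderIso {n : ℕ} {F G : List SgnTree} (h : ForestStep F G)
    (hF : RankLE n F) : Nonempty (linSum F ≃o linSum G) :=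
  (isCopy_univ F).nonempty_orderIso (h.isCopy hF (isCopy_univ F))

/-- L-equivalent forests have isomorphic linear orders. -/
theorem ForestEquiv.nonempty_orderIso {n : ℕ} {F G : List SgnTree} (h : F ≈ₗ G)
    (hF : RankLE n F) : Nonempty (linSum F ≃o linSum G) := by
  induction h with
  | rel F G h => exact h.nonempty_orderIso hF
  | refl F => exact ⟨OrderIso.refl _⟩
  | symm F G h ih =>
    obtain ⟨e⟩ := ih ((ForestEquiv.rankLE_iff h n).2 hF)
    exact ⟨e.symm⟩
  | trans F G H h _ ih ih' =>
    obtain ⟨e⟩ := ih hF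
    obtain ⟨e'⟩ := ih' ((ForestEquiv.rankLE_iff h n).1 hF)
    exact ⟨e.trans e'⟩

theorem ForestEquiv.isCopy {n : ℕ} {F G : List SgnTree} (h : F ≈ₗ G) (hF : RankLE n F)
    {X : Type*} [LinearOrder X] {S : Set X} (hS : IsCopy F S) : IsCopy G S := by
  obtain ⟨e⟩ := h.nonempty_orderIso hF
  exact hS.congr e

/-! ### Cuts of an `ω`-sum -/

section Cut

variable {X : Type*} [LinearOrder X] {T : ℕ → Set X} {C D : Set X} {k : ℕ} {w : List SgnTree}

theorem Before.disjoint (h : Before C D) {x : X} (hC : x ∈ C) (hD : x ∈ D) : False :=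
  lt_irrefl x (h x hC x hD)

/-- A cut `(C, D)` of an `ω`-sum of the blocks `T i` with `D` non-empty cuts one of the blocks;
the earlier blocks lie below the cut and the later ones above it. -/
theorem exists_cut_index (hT : ∀ i j, i < j → Before (T i) (T j)) (hCD : Before C D)
    (hU : ⋃ i, T i = C ∪ D) (hD : D.Nonempty) :
    ∃ k, (∀ i < k, T i ⊆ C) ∧ ∀ i, k < i → T i ⊆ D := by
  classical
  have hex : ∃ k, (T k ∩ D).Nonempty := by
    obtain ⟨x, hx⟩ := hD
    have : x ∈ ⋃ i, T i := hU ▸ Or.inr hx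
    obtain ⟨k, hk⟩ := Set.mem_iUnion.1 this
    exact ⟨k, x, hk, hx⟩
  have hsub : ∀ i, T i ⊆ C ∪ D := fun i => hU ▸ Set.subset_iUnion T i
  refine ⟨Nat.find hex, fun i hi x hx => ?_, fun i hi x hx => ?_⟩
  · exact (hsub i hx).resolve_right fun hxD => Nat.find_min hex hi ⟨x, hx, hxD⟩
  · obtain ⟨d, hd, hdD⟩ := Nat.find_spec hex
    exact (hsub i hx).resolve_left fun hxC =>
      lt_asymm (hCD x hxC d hdD) (hT _ _ hi d hd x hx)

theorem isCopy_below_cut (hT : ∀ i j, i < j → Before (T i) (T j)) (hc : ∀ i, IsCopy w (T i))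
    (hCD : Before C D) (hU : ⋃ i, T i = C ∪ D) (h₁ : ∀ i < k, T i ⊆ C)
    (h₂ : ∀ i, k < i → T i ⊆ D) {p : List SgnTree} (hp : IsCopy p (T k ∩ C)) :
    IsCopy (listPow w k ++ p) C := by
  have hC : C = (⋃ i ∈ Set.Ico 0 (0 + k), T i) ∪ (T k ∩ C) := by
    refine Set.Subset.antisymm (fun x hx => ?_)
      (Set.union_subset (Set.iUnion₂_subset fun i hi => h₁ i (by simpa using hi))
        Set.inter_subset_right)
    have : x ∈ ⋃ i, T i := hU ▸ Or.inl hx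
    obtain ⟨i, hi⟩ := Set.mem_iUnion.1 this
    rcases lt_trichotomy i k with h | rfl | h
    · exact Or.inl (Set.mem_biUnion (by simpa using h) hi)
    · exact Or.inr ⟨hi, hx⟩
    · exact (hCD.disjoint hx (h₂ i h hi)).elim
  rw [hC]
  exact (isCopy_listPow hT hc 0 k).append hp <| .iUnion_left fun i => .iUnion_left fun hi =>
    (hT i k (by simpa using hi)).mono subset_rfl Set.inter_subset_left

theorem isCopy_above_cut (hw : w ≠ []) (hT : ∀ i j, i < j → Before (T i) (T j))
    (hc : ∀ i, IsCopy w (T i)) (hCD : Before C D) (hU : ⋃ i, T i = C ∪ D)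
    (h₁ : ∀ i < k, T i ⊆ C) (h₂ : ∀ i, k < i → T i ⊆ D) {q : List SgnTree}
    (hq : IsCopy q (T k ∩ D)) : IsCopy (q ++ [node .pos w]) D := by
  have hD : D = (T k ∩ D) ∪ (⋃ i ∈ Set.Ici (k + 1), T i) := by
    refine Set.Subset.antisymm (fun x hx => ?_)
      (Set.union_subset Set.inter_subset_right (Set.iUnion₂_subset fun i hi => h₂ i hi))
    have : x ∈ ⋃ i, T i := hU ▸ Or.inr hx
    obtain ⟨i, hi⟩ := Set.mem_iUnion.1 this
    rcases lt_trichotomy i k with h | rfl | h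
    · exact (hCD.disjoint (h₁ i h hi) hx).elim
    · exact Or.inl ⟨hi, hx⟩
    · exact Or.inr (Set.mem_biUnion (Nat.succ_le_of_lt h) hi)
  rw [hD]
  exact hq.append (isCopy_tail hw hT hc (k + 1)) <| .iUnion_right fun i => .iUnion_right fun hi =>
    (hT k i hi).mono Set.inter_subset_left subset_rfl

end Cut

/-! ### Finitely many types of cuts -/

/-- The cuts of the linear order of `F` fall into finitely many types `i : ι`. A cut of type `i`
has its lower part presented by a forest in `P i` and its upper part by a forest in `Q i`. The
lower part of any cut of type `i` and the upper part of any other cut of the same type fit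
together to a forest L-equivalent to `F`. -/
def HasFiniteCutTypes (F : List SgnTree) : Prop :=
  ∃ (ι : Type) (_ : Finite ι) (P Q : ι → Set (List SgnTree)),
    (∀ i, ∀ p ∈ P i, ∀ q ∈ Q i, p ++ q ≈ₗ F) ∧
    ∀ (X : Type) [LinearOrder X] (C D : Set X), Before C D → IsCopy F (C ∪ D) →
      ∃ i, (∃ p ∈ P i, IsCopy p C) ∧ ∃ q ∈ Q i, IsCopy q D

theorem hasFiniteCutTypes_nil : HasFiniteCutTypes [] := by
  refine ⟨Unit, inferInstance, fun _ => {[]}, fun _ => {[]}, ?_, ?_⟩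
  · rintro i p rfl q rfl
    exact .refl _
  · intro X _ C D _ h
    rw [isCopy_nil, Set.union_empty_iff] at h
    exact ⟨(), by simp [h.1], by simp [h.2]⟩

theorem hasFiniteCutTypes_leaf : HasFiniteCutTypes [node 0 []] := by
  refine ⟨Bool, inferInstance, fun b => {cond b [] [node 0 []]}, fun b => {cond b [node 0 []] []},
    ?_, ?_⟩
  · rintro (_ | _) p rfl q rfl <;> exact .refl _
  · intro X _ C D hCD h
    obtain ⟨x, hx⟩ := isCopy_leaf.1 h
    have hxm : x ∈ C ∪ D := hx ▸ rfl
    have hCx : C ⊆ {x} := hx ▸ Set.subset_union_left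
    have hDx : D ⊆ {x} := hx ▸ Set.subset_union_right
    rcases hxm with hxC | hxD
    · refine ⟨false, ⟨_, rfl, isCopy_leaf.2 ⟨x, hCx.antisymm (by simpa using hxC)⟩⟩,
        _, rfl, isCopy_nil.2 (Set.eq_empty_of_forall_notMem fun y hy => ?_)⟩
      obtain rfl := hDx hy
      exact hCD.disjoint hxC hy
    · refine ⟨true, ⟨_, rfl, isCopy_nil.2 (Set.eq_empty_of_forall_notMem fun y hy => ?_)⟩,
        _, rfl, isCopy_leaf.2 ⟨x, hDx.antisymm (by simpa using hxD)⟩⟩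
      obtain rfl := hCx hy
      exact hCD.disjoint hy hxD

theorem HasFiniteCutTypes.append {F G : List SgnTree} (hF : HasFiniteCutTypes F)
    (hG : HasFiniteCutTypes G) : HasFiniteCutTypes (F ++ G) := by
  obtain ⟨ι, _, P, Q, h1, h2⟩ := hF
  obtain ⟨κ, _, P', Q', h1', h2'⟩ := hG
  refine ⟨ι ⊕ κ, inferInstance, Sum.elim P fun i => (F ++ ·) '' P' i,
    Sum.elim (fun i => (· ++ G) '' Q i) Q', ?_, ?_⟩
  · rintro (i | i) p hp q hq
    · obtain ⟨q, hq, rfl⟩ := hq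
      simpa using (h1 i p hp q hq).append_right G
    · obtain ⟨p, hp, rfl⟩ := hp
      simpa using (h1' i p hp q hq).append_left F
  · intro X _ C D hCD h
    obtain ⟨S₁, S₂, hb, hU, hS₁, hS₂⟩ := isCopy_append.1 h
    have hS₁U : S₁ ⊆ C ∪ D := hU ▸ Set.subset_union_left
    have hS₂U : S₂ ⊆ C ∪ D := hU ▸ Set.subset_union_right
    have hCU : C ⊆ S₁ ∪ S₂ := hU ▸ Set.subset_union_left
    have hDU : D ⊆ S₁ ∪ S₂ := hU ▸ Set.subset_union_right
    by_cases hd : (S₁ ∩ D).Nonempty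
    · -- the cut lies inside the copy of `F`
      obtain ⟨d, hd₁, hdD⟩ := hd
      have hS₂D : S₂ ⊆ D := fun x hx => (hS₂U hx).resolve_left fun hxC =>
        lt_asymm (hCD x hxC d hdD) (hb d hd₁ x hx)
      have hC : C ⊆ S₁ := fun x hx => (hCU hx).resolve_right fun hx₂ =>
        hCD.disjoint hx (hS₂D hx₂)
      have e₁ : S₁ = C ∪ (S₁ ∩ D) := by
        rw [Set.union_inter_distrib_left, Set.union_eq_self_of_subset_left hC,
          Set.inter_eq_left.2 hS₁U]
      have e₂ : D = (S₁ ∩ D) ∪ S₂ := by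
        rw [Set.inter_union_distrib_right, Set.union_eq_self_of_subset_right hS₂D,
          Set.inter_eq_right.2 hDU]
      rw [e₁] at hS₁
      obtain ⟨i, ⟨p, hp, hpC⟩, q, hq, hqD⟩ :=
        h2 X C (S₁ ∩ D) (hCD.mono subset_rfl Set.inter_subset_right) hS₁
      refine ⟨.inl i, ⟨p, hp, hpC⟩, q ++ G, ⟨q, hq, rfl⟩, ?_⟩
      rw [e₂]
      exact hqD.append hS₂ (hb.mono Set.inter_subset_left subset_rfl)
    · -- the cut lies inside the copy of `G`
      have hS₁C : S₁ ⊆ C := fun x hx => (hS₁U hx).resolve_right fun hxD => hd ⟨x, hx, hxD⟩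
      have hD : D ⊆ S₂ := fun x hx => (hDU hx).resolve_left fun hx₁ =>
        hCD.disjoint (hS₁C hx₁) hx
      have e₁ : S₂ = (S₂ ∩ C) ∪ D := by
        rw [Set.inter_union_distrib_right, Set.union_eq_self_of_subset_right hD,
          Set.inter_eq_left.2 hS₂U]
      have e₂ : C = S₁ ∪ (S₂ ∩ C) := by
        rw [Set.union_inter_distrib_left, Set.union_eq_self_of_subset_left hS₁C,
          Set.inter_eq_right.2 hCU]
      rw [e₁] at hS₂
      obtain ⟨i, ⟨p, hp, hpC⟩, q, hq, hqD⟩ :=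
        h2' X (S₂ ∩ C) D (hCD.mono Set.inter_subset_right subset_rfl) hS₂
      refine ⟨.inr i, ⟨F ++ p, ⟨p, hp, rfl⟩, ?_⟩, q, hq, hqD⟩
      rw [e₂]
      exact hS₁.append hpC (hb.mono subset_rfl Set.inter_subset_left)

/-- The number of the copy of `w` in which a cut of `w^ω` lies is not part of its type: it affects
only the lower part `w^k p`, which is completed to `w^ω` by every `q w^ω` with `p q ≈ w`. -/
theorem HasFiniteCutTypes.pos {w : List SgnTree} (hw : w ≠ []) (h : HasFiniteCutTypes w) :
    HasFiniteCutTypes [node .pos w] := by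
  obtain ⟨ι, _, P, Q, h1, h2⟩ := h
  refine ⟨Option ι, inferInstance,
    fun o => o.elim {[node .pos w]} fun i => {F | ∃ k, ∃ p ∈ P i, F = listPow w k ++ p},
    fun o => o.elim {[]} fun i => (· ++ [node .pos w]) '' Q i, ?_, ?_⟩
  · rintro (_ | i) p hp q hq
    · obtain rfl := hp
      obtain rfl := hq
      exact .refl _
    · obtain ⟨k, p, hp, rfl⟩ := hp
      obtain ⟨q, hq, rfl⟩ := hq
      have := ((h1 i p hp q hq).append_right [node .pos w]).trans (.absorb w)
      have := (this.append_left (listPow w k)).trans (.listPow_absorb w k)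
      simpa using this
  · intro X _ C D hCD h
    rcases D.eq_empty_or_nonempty with rfl | hD
    · rw [Set.union_empty] at h
      exact ⟨none, ⟨_, rfl, h⟩, _, rfl, by simp⟩
    · obtain ⟨T, hT, hU, hc⟩ := (isCopy_pos hw).1 h
      obtain ⟨k, hk₁, hk₂⟩ := exists_cut_index hT hCD hU.symm hD
      have hTk : T k = (T k ∩ C) ∪ (T k ∩ D) := by
        rw [← Set.inter_union_distrib_left, hU, Set.inter_eq_left.2 (Set.subset_iUnion T k)]
      obtain ⟨i, ⟨p, hp, hpC⟩, q, hq, hqD⟩ := h2 X (T k ∩ C) (T k ∩ D)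
        (hCD.mono Set.inter_subset_right Set.inter_subset_right) (hTk ▸ hc k)
      exact ⟨some i, ⟨_, ⟨k, p, hp, rfl⟩, isCopy_below_cut hT hc hCD hU.symm hk₁ hk₂ hpC⟩,
        _, ⟨q, hq, rfl⟩, isCopy_above_cut hw hT hc hCD hU.symm hk₁ hk₂ hqD⟩

theorem HasFiniteCutTypes.reverse {n : ℕ} {F : List SgnTree} (hF : RankLE n F)
    (h : HasFiniteCutTypes F) : HasFiniteCutTypes (reverseList F) := by
  obtain ⟨ι, _, P, Q, h1, h2⟩ := h
  refine ⟨ι, inferInstance, fun i => {p | reverseList p ∈ Q i},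
    fun i => {q | reverseList q ∈ P i}, ?_, ?_⟩
  · intro i p hp q hq
    simpa using (h1 i _ hq _ hp).reverse
  · intro X _ C D hCD h
    have h' : IsCopy F (OrderDual.ofDual ⁻¹' D ∪ OrderDual.ofDual ⁻¹' C) := by
      rw [Set.union_comm]
      simpa using h.reverse hF.reverse
    obtain ⟨i, ⟨p, hp, hpD⟩, q, hq, hqC⟩ := h2 Xᵒᵈ _ _ hCD.dual h'
    -- both sides of the cut have bounded height because together they are L-equivalent to `F`
    obtain ⟨hnp, hnq⟩ := rankLE_append.1 (((h1 i p hp q hq).rankLE_iff n).2 hF)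
    exact ⟨i, ⟨reverseList q, by simpa using hq, hqC.of_reverse hnq⟩,
      reverseList p, by simpa using hp, hpD.of_reverse hnp⟩

theorem RankLE.hasFiniteCutTypes {n : ℕ} {F : List SgnTree} (hF : RankLE n F) :
    HasFiniteCutTypes F := by
  have list : ∀ F : List SgnTree, (∀ t ∈ F, HasFiniteCutTypes [t]) → HasFiniteCutTypes F := by
    intro F hF
    induction F with
    | nil => exact hasFiniteCutTypes_nil
    | cons t F ih =>
      exact (hF t (by simp)).append (G := F) (ih fun t' ht' => hF t' (by simp [ht']))
  induction n generalizing F with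
  | zero => exact list F fun t ht => by rw [hF t ht]; exact hasFiniteCutTypes_leaf
  | succ n ih =>
    refine list F fun t ht => ?_
    rcases hF t ht with rfl | ⟨h0, h1, h2⟩
    · exact hasFiniteCutTypes_leaf
    · obtain ⟨s, w⟩ := t
      cases s with
      | zero => exact absurd rfl h0
      | pos => exact (ih h2).pos h1
      | neg =>
        have h3 : reverseList w ≠ [] := by simpa [children] using h1
        have h4 : RankLE (n + 1) [node .pos (reverseList w)] :=
          (rankLE_succ_node (by decide)).2 ⟨h3, h2.reverse⟩
        simpa [children] using ((ih h2.reverse).pos h3).reverse h4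

/-! ### Forests with isomorphic linear orders are L-equivalent -/

/-- The linear order of `F` determines `F` up to L-equivalence. -/
def IsDetermined (F : List SgnTree) : Prop :=
  ∀ (m : ℕ) (G : List SgnTree), RankLE m G → Nonempty (linSum F ≃o linSum G) → F ≈ₗ G

theorem IsDetermined.forestEquiv {F G : List SgnTree} (hF : IsDetermined F) {m : ℕ}
    (hG : RankLE m G) {X : Type*} [LinearOrder X] {S : Set X} (h : IsCopy F S)
    (h' : IsCopy G S) : F ≈ₗ G :=
  hF m G hG (h.nonempty_orderIso h')

theorem isDetermined_nil : IsDetermined [] := by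
  rintro m (_ | ⟨t, G⟩) hG ⟨e⟩
  · exact .refl _
  · have h : IsCopy [] (Set.univ : Set (linSum (t :: G))) := (isCopy_univ _).congr e.symm
    obtain ⟨x, -⟩ := (isCopy_univ (t :: G)).nonempty hG (by simp)
    have hx : x ∈ (∅ : Set (linSum (t :: G))) := isCopy_nil.1 h ▸ Set.mem_univ x
    exact hx.elim

/-- Cutting a presentation `G` of the order of `F ++ F'` at the boundary between `F` and `F'`
reduces the question to `F` and `F'`. -/
theorem IsDetermined.append {F F' : List SgnTree} (hF : IsDetermined F) (hF' : IsDetermined F') :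
    IsDetermined (F ++ F') := by
  rintro m G hG ⟨e⟩
  have hGu : IsCopy G (Set.univ : Set (linSum (F ++ F'))) := (isCopy_univ (F ++ F')).congr e
  obtain ⟨C, D, hCD, hU, hC, hD⟩ := isCopy_append.1 (isCopy_univ (F ++ F'))
  obtain ⟨ι, _, P, Q, h1, h2⟩ := hG.hasFiniteCutTypes
  obtain ⟨i, ⟨p, hp, hpC⟩, q, hq, hqD⟩ := h2 _ C D hCD (hU ▸ hGu)
  have hpq := h1 i p hp q hq
  obtain ⟨hmp, hmq⟩ := rankLE_append.1 ((hpq.rankLE_iff m).2 hG)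
  exact ((hF.forestEquiv hmp hC hpC).append (hF'.forestEquiv hmq hD hqD)).trans hpq

theorem isDetermined_leaf : IsDetermined [node 0 []] := by
  rintro m G hG ⟨e⟩
  have hGu : IsCopy G (Set.univ : Set (linSum [node 0 []])) := (isCopy_univ [node 0 []]).congr e
  obtain ⟨x, hx⟩ := isCopy_leaf.1 (isCopy_univ [node 0 []])
  have hall : ∀ y : linSum [node 0 []], y = x := fun y =>
    (hx ▸ Set.mem_univ y : y ∈ ({x} : Set (linSum [node 0 []])))
  have hlt : ∀ {A B : Set (linSum [node 0 []])}, Before A B → A.Nonempty → B.Nonempty → False := by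
    rintro A B hAB ⟨a, ha⟩ ⟨b, hb⟩
    have := hAB a ha b hb
    rw [hall a, hall b] at this
    exact lt_irrefl _ this
  obtain _ | ⟨t, G⟩ := G
  · have hxe : x ∈ (∅ : Set (linSum [node 0 []])) := isCopy_nil.1 hGu ▸ Set.mem_univ x
    exact hxe.elim
  obtain ⟨ht, hG'⟩ := rankLE_cons.1 hG
  obtain ⟨S₁, S₂, hb, hU, h₁, h₂⟩ := isCopy_cons.1 hGu
  obtain rfl : G = [] := by
    by_contra hne
    exact hlt hb (h₁.nonempty ht (by simp)) (h₂.nonempty hG' hne)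
  cases m with
  | zero =>
    rw [ht t (by simp)]
    exact .refl _
  | succ m =>
    rcases ht t (by simp) with rfl | ⟨h3, h4, h5⟩
    · exact .refl _
    · obtain ⟨s, w⟩ := t
      cases s with
      | zero => exact absurd rfl h3
      | pos =>
        obtain ⟨T, hT, -, hc⟩ := (isCopy_pos h4).1 h₁
        exact (hlt (hT 0 1 one_pos) ((hc 0).nonempty h5 h4) ((hc 1).nonempty h5 h4)).elim
      | neg =>
        obtain ⟨T, hT, -, hc⟩ := (isCopy_neg h4).1 h₁
        exact (hlt (hT 1 0 one_pos) ((hc 1).nonempty h5 h4) ((hc 0).nonempty h5 h4)).elim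

/-- A cut of `w^ω` with non-empty upper part: the lower part needs no more height than `w`, and the
upper part is some `q w^ω`. -/
theorem exists_cut_pos {n : ℕ} {w : List SgnTree} (hn : RankLE n w) (hw : w ≠ []) {X : Type}
    [LinearOrder X] {C D : Set X} (hCD : Before C D) (hD : D.Nonempty)
    (h : IsCopy [node .pos w] (C ∪ D)) :
    ∃ p q, RankLE n p ∧ RankLE n q ∧ IsCopy p C ∧ IsCopy (q ++ [node .pos w]) D := by
  obtain ⟨T, hT, hU, hc⟩ := (isCopy_pos hw).1 h
  obtain ⟨k, hk₁, hk₂⟩ := exists_cut_index hT hCD hU.symm hD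
  have hTk : T k = (T k ∩ C) ∪ (T k ∩ D) := by
    rw [← Set.inter_union_distrib_left, hU, Set.inter_eq_left.2 (Set.subset_iUnion T k)]
  obtain ⟨ι, _, P, Q, h1, h2⟩ := hn.hasFiniteCutTypes
  obtain ⟨i, ⟨p, hp, hpC⟩, q, hq, hqD⟩ := h2 X (T k ∩ C) (T k ∩ D)
    (hCD.mono Set.inter_subset_right Set.inter_subset_right) (hTk ▸ hc k)
  obtain ⟨hmp, hmq⟩ := rankLE_append.1 (((h1 i p hp q hq).rankLE_iff n).2 hn)
  exact ⟨listPow w k ++ p, q, rankLE_append.2 ⟨hn.listPow k, hmp⟩, hmq,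
    isCopy_below_cut hT hc hCD hU.symm hk₁ hk₂ hpC,
    isCopy_above_cut hw hT hc hCD hU.symm hk₁ hk₂ hqD⟩

/-- If the height `n` of `w` is exact, no non-empty final segment of `w^ω` is presented by a forest
of height at most `n`: it would be L-equivalent to some `q w^ω`, and L-equivalence preserves
height. -/
theorem not_isCopy_final_segment {n : ℕ} {w : List SgnTree} (hn : RankLE n w) (hw : w ≠ [])
    (hmin : ∀ l < n, ¬ RankLE l w) (ih : ∀ F, RankLE n F → IsDetermined F) {X : Type}
    [LinearOrder X] {C D : Set X} (hCD : Before C D) (hD : D.Nonempty)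
    (h : IsCopy [node .pos w] (C ∪ D)) {z : List SgnTree} (hz : RankLE n z) : ¬ IsCopy z D := by
  intro hzD
  obtain ⟨p, q, -, hq, -, hqD⟩ := exists_cut_pos hn hw hCD hD h
  have hpos : SignType.pos ≠ 0 := by decide
  have hz' : z ≈ₗ q ++ [node .pos w] := (ih z hz).forestEquiv
    (rankLE_append.2 ⟨hq.succ, (rankLE_succ_node hpos).2 ⟨hw, hn⟩⟩) hzD hqD
  obtain ⟨l, rfl, -, hl⟩ :=
    (rankLE_append.1 ((hz'.rankLE_iff n).1 hz)).2.exists_of_node hpos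
  exact hmin l (by omega) hl

theorem ForestEquiv.neg_absorb (z : List SgnTree) :
    [SgnTree.node .neg z] ++ z ≈ₗ [SgnTree.node .neg z] := by
  simpa using (ForestEquiv.absorb (reverseList z)).reverse

/-- The cuts after `G' z^j` of an order presented both by `w^ω` and by `G' z^ω` lie in copies of
`w` whose number grows with `j`. Two of them, for `j < j'`, are of the same type, so
`G' z^j ≈ w^k p`, `z^(j'-j) ≈ q w^r p'` and `p q ≈ p' q ≈ w`, whence `G' z^ω ≈ w^k p (q w^r p')^ω ≈
w^k p q (w^r p' q)^ω ≈ w^ω`. -/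
theorem forestEquiv_of_isCopy_pos {n m : ℕ} {w z G : List SgnTree} (hn : RankLE n w) (hw : w ≠ [])
    (ih : ∀ F, RankLE n F → IsDetermined F) (hz : RankLE m z) (hz0 : z ≠ []) (hG : RankLE m G)
    {X : Type} [LinearOrder X] {S : Set X} (h : IsCopy [node .pos w] S)
    (h' : IsCopy (G ++ [node .pos z]) S) : [node .pos w] ≈ₗ G ++ [node .pos z] := by
  obtain ⟨T, hT, hU, hc⟩ := (isCopy_pos hw).1 h
  obtain ⟨H, R, hHR, rfl, hH, hR⟩ := isCopy_append.1 h'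
  obtain ⟨V, hV, rfl, hcV⟩ := (isCopy_pos hz0).1 hR
  -- the two sides of the cut after `G z^j`
  set C : ℕ → Set X := fun j => H ∪ ⋃ i ∈ Set.Ico 0 (0 + j), V i with hCdef
  set D : ℕ → Set X := fun j => ⋃ i ∈ Set.Ici j, V i with hDdef
  have hHV : ∀ i, Before H (V i) := fun i => hHR.mono subset_rfl (Set.subset_iUnion V i)
  have hCD : ∀ j, Before (C j) (D j) := fun j =>
    .union_left (.iUnion_right fun i => .iUnion_right fun _ => hHV i)
      (.iUnion_left fun i => .iUnion_left fun hi => .iUnion_right fun i' => .iUnion_right fun hi' =>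
        hV i i' (by have := hi.2; have := Set.mem_Ici.1 hi'; omega))
  have hCDU : ∀ j, ⋃ i, T i = C j ∪ D j := by
    intro j
    rw [← hU, hCdef, hDdef, Set.union_assoc, ← Set.biUnion_union]
    congr 1
    ext x
    simp only [Set.mem_iUnion, Set.mem_union, Set.mem_Ico, Set.mem_Ici]
    exact ⟨fun ⟨i, hi⟩ => ⟨i, by omega, hi⟩, fun ⟨i, _, hi⟩ => ⟨i, hi⟩⟩
  have hDn : ∀ j, (D j).Nonempty := fun j =>
    ((hcV j).nonempty hz hz0).mono fun x hx => Set.mem_biUnion Set.self_mem_Ici hx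
  have hCc : ∀ j, IsCopy (G ++ listPow z j) (C j) := fun j =>
    hH.append (isCopy_listPow hV hcV 0 j) (.iUnion_right fun i => .iUnion_right fun _ => hHV i)
  choose k hk₁ hk₂ using fun j => exists_cut_index hT (hCD j) (hCDU j) (hDn j)
  obtain ⟨ι, _, P, Q, h1, h2⟩ := hn.hasFiniteCutTypes
  have hTk : ∀ i j, T i = (T i ∩ C j) ∪ (T i ∩ D j) := fun i j => by
    rw [← Set.inter_union_distrib_left, ← hCDU, Set.inter_eq_left.2 (Set.subset_iUnion T i)]
  choose τ hp hq using fun j => h2 X (T (k j) ∩ C j) (T (k j) ∩ D j)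
    ((hCD j).mono Set.inter_subset_right Set.inter_subset_right) (hTk (k j) j ▸ hc (k j))
  choose p hpP hpC using hp
  choose q hqQ hqD using hq
  have hCmono : ∀ i j, i ≤ j → C i ⊆ C j := fun i j hij =>
    Set.union_subset_union_right H (Set.biUnion_subset_biUnion_left
      (Set.Ico_subset_Ico_right (by omega)))
  -- the cuts leave every copy of `w`
  have hunb : ∀ K, ∃ j₀, ∀ j, j₀ ≤ j → K < k j := by
    intro K
    obtain ⟨y, hy⟩ := (hc (K + 1)).nonempty hn hw
    have hyU : y ∈ H ∪ ⋃ i, V i := hU ▸ Set.mem_iUnion_of_mem (K + 1) hy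
    obtain ⟨j₀, hj₀⟩ : ∃ j₀, y ∈ C j₀ := by
      rcases hyU with hy | hy
      · exact ⟨0, Or.inl hy⟩
      · obtain ⟨i, hi⟩ := Set.mem_iUnion.1 hy
        exact ⟨i + 1, Or.inr (Set.mem_biUnion (x := i) (by simp) hi)⟩
    refine ⟨j₀, fun j hj => ?_⟩
    by_contra hle
    exact (hCD j).disjoint (hCmono j₀ j hj hj₀) (hk₂ j (K + 1) (by omega) hy)
  obtain ⟨i₀, hi₀⟩ := Finite.exists_infinite_fiber τ
  have hinf : (τ ⁻¹' {i₀}).Infinite := Set.infinite_coe_iff.1 hi₀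
  obtain ⟨j, hj⟩ := hinf.nonempty
  obtain ⟨j₀, hj₀⟩ := hunb (k j)
  obtain ⟨j', hj', hlt⟩ := hinf.exists_gt (max j j₀)
  have hjj' : j < j' := (le_max_left _ _).trans_lt hlt
  have hkk' : k j < k j' := hj₀ j' ((le_max_right _ _).trans hlt.le)
  obtain ⟨r, hr⟩ := Nat.exists_eq_add_of_lt hkk'
  have hpq : p j ++ q j ≈ₗ w := h1 (τ j) _ (hpP j) _ (hqQ j)
  have hpq' : p j' ++ q j ≈ₗ w := by
    have e : τ j' = τ j := (show τ j' = i₀ from hj').trans (show τ j = i₀ from hj).symm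
    exact h1 (τ j) _ (e ▸ hpP j') _ (hqQ j)
  have hnpq := rankLE_append.1 ((hpq.rankLE_iff n).2 hn)
  have hnpq' := rankLE_append.1 ((hpq'.rankLE_iff n).2 hn)
  -- the part below the first of the two cuts
  have E₁ : listPow w (k j) ++ p j ≈ₗ G ++ listPow z j :=
    (ih _ (rankLE_append.2 ⟨hn.listPow _, hnpq.1⟩)).forestEquiv
      (rankLE_append.2 ⟨hG, hz.listPow _⟩)
      (isCopy_below_cut hT hc (hCD j) (hCDU j) (hk₁ j) (hk₂ j) (hpC j)) (hCc j)
  -- the part between the two cuts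
  have E₂ : q j ++ listPow w r ++ p j' ≈ₗ listPow z (j' - j) := by
    have hset : (⋃ i ∈ Set.Ico j (j + (j' - j)), V i) =
        (T (k j) ∩ D j) ∪ (⋃ i ∈ Set.Ico (k j + 1) (k j + 1 + r), T i) ∪ (T (k j') ∩ C j') := by
      have hI : (⋃ i ∈ Set.Ico j (j + (j' - j)), V i) = D j ∩ C j' := by
        ext x
        constructor
        · intro hx
          obtain ⟨i, hi, hx⟩ := Set.mem_iUnion₂.1 hx
          refine ⟨Set.mem_biUnion hi.1 hx, Or.inr (Set.mem_biUnion (x := i) ?_ hx)⟩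
          have := hi.2
          simp only [Set.mem_Ico]
          omega
        · rintro ⟨hxD, hxH | hxC⟩
          · exact ((hCD j).disjoint (Or.inl hxH) hxD).elim
          · obtain ⟨i, hi, hx⟩ := Set.mem_iUnion₂.1 hxC
            refine Set.mem_biUnion (x := i) ⟨?_, by have := hi.2; omega⟩ hx
            by_contra hij
            exact (hCD j).disjoint
              (Or.inr (Set.mem_biUnion (x := i) (by simp; omega) hx)) hxD
      rw [hI]
      ext x
      constructor
      · rintro ⟨hxD, hxC⟩
        have hx : x ∈ ⋃ i, T i := by rw [hCDU j]; exact Or.inr hxD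
        obtain ⟨i, hi⟩ := Set.mem_iUnion.1 hx
        have hi₁ : k j ≤ i := by
          by_contra hlt
          exact (hCD j).disjoint (hk₁ j i (by omega) hi) hxD
        have hi₂ : i ≤ k j' := by
          by_contra hlt
          exact (hCD j').disjoint hxC (hk₂ j' i (by omega) hi)
        rcases hi₁.eq_or_lt with rfl | hi₁
        · exact Or.inl (Or.inl ⟨hi, hxD⟩)
        rcases hi₂.eq_or_lt with rfl | hi₂
        · exact Or.inr ⟨hi, hxC⟩
        exact Or.inl (Or.inr (Set.mem_biUnion (x := i) ⟨by omega, by omega⟩ hi))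
      · rintro ((⟨hi, hxD⟩ | hx) | ⟨hi, hxC⟩)
        · exact ⟨hxD, hk₁ j' _ hkk' hi⟩
        · obtain ⟨i, hi, hx⟩ := Set.mem_iUnion₂.1 hx
          have h₁ := hi.1
          have h₂ := hi.2
          exact ⟨hk₂ j i (by omega) hx, hk₁ j' i (by omega) hx⟩
        · exact ⟨hk₂ j _ hkk' hi, hxC⟩
    have hcopy := isCopy_listPow hV hcV j (j' - j)
    rw [hset] at hcopy
    refine (ih _ (rankLE_append.2 ⟨rankLE_append.2 ⟨hnpq.2, hn.listPow _⟩,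
      hnpq'.1⟩)).forestEquiv (hz.listPow _) (IsCopy.append (IsCopy.append (hqD j)
        (isCopy_listPow hT hc (k j + 1) r) ?_) (hpC j') ?_) hcopy
    · exact .iUnion_right fun i => .iUnion_right fun hi =>
        (hT _ _ hi.1).mono Set.inter_subset_left subset_rfl
    · refine .union_left ((hT _ _ hkk').mono Set.inter_subset_left Set.inter_subset_left) ?_
      exact .iUnion_left fun i => .iUnion_left fun hi =>
        (hT _ _ (by have := hi.2; omega)).mono subset_rfl Set.inter_subset_left
  have E₃ : [node .pos z] ≈ₗ q j ++ [node .pos w] :=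
    calc [node .pos z] ≈ₗ [node .pos (listPow z (j' - j))] := .node_listPow z (by omega)
      _ ≈ₗ [node .pos (q j ++ listPow w r ++ p j')] := E₂.symm.node _
      _ ≈ₗ q j ++ [node .pos (listPow w r ++ p j' ++ q j)] := by
        simpa using ForestEquiv.rotate (q j) (listPow w r ++ p j')
      _ ≈ₗ q j ++ [node .pos (listPow w (r + 1))] := by
        refine .append_left _ (.node _ ?_)
        rw [listPow_succ', List.append_assoc]
        exact hpq'.append_left _
      _ ≈ₗ q j ++ [node .pos w] := .append_left _ (ForestEquiv.node_listPow w (by omega)).symm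
  refine ForestEquiv.symm ?_
  calc G ++ [node .pos z] ≈ₗ G ++ (listPow z j ++ [node .pos z]) :=
        .append_left _ (ForestEquiv.listPow_absorb z j).symm
    _ ≈ₗ (listPow w (k j) ++ p j) ++ (q j ++ [node .pos w]) := by
        rw [← List.append_assoc]
        exact E₁.symm.append E₃
    _ ≈ₗ listPow w (k j) ++ (w ++ [node .pos w]) := by
        simpa using (hpq.append_right [node .pos w]).append_left (listPow w (k j))
    _ ≈ₗ listPow w (k j) ++ [node .pos w] := (ForestEquiv.absorb w).append_left _
    _ ≈ₗ [node .pos w] := .listPow_absorb w _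

theorem IsDetermined.pos {n : ℕ} {w : List SgnTree} (hn : RankLE n w) (hw : w ≠ [])
    (ih : ∀ F, RankLE n F → IsDetermined F) : IsDetermined [node .pos w] := by
  classical
  -- replace `n` by the exact height of `w`
  obtain ⟨n, hn, hmin, ih⟩ : ∃ n, RankLE n w ∧ (∀ l < n, ¬ RankLE l w) ∧
      ∀ F, RankLE n F → IsDetermined F := by
    have hex : ∃ n, RankLE n w := ⟨n, hn⟩
    exact ⟨Nat.find hex, Nat.find_spec hex, fun l hl => Nat.find_min hex hl,
      fun F hF => ih F (hF.mono (Nat.find_min' hex hn))⟩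
  rintro m G hG ⟨e⟩
  have h : IsCopy [node .pos w] (Set.univ : Set (linSum [node .pos w])) := isCopy_univ _
  have h' : IsCopy G (Set.univ : Set (linSum [node .pos w])) := h.congr e
  have hrank : RankLE (n + 1) [node .pos w] := (rankLE_succ_node (by decide)).2 ⟨hw, hn⟩
  rcases List.eq_nil_or_concat G with rfl | ⟨G, t, rfl⟩
  · obtain ⟨x, hx⟩ := h.nonempty hrank (by simp)
    rw [isCopy_nil.1 h'] at hx
    exact hx.elim
  rw [List.concat_eq_append] at *
  obtain ⟨hG', ht⟩ := rankLE_append.1 hG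
  have hleaf : t ≠ node 0 [] := by
    rintro rfl
    obtain ⟨C, D, hCD, hU, -, hD⟩ := isCopy_append.1 h'
    rw [hU] at h
    exact not_isCopy_final_segment hn hw hmin ih hCD (hD.nonempty ht (by simp)) h
      (rankLE_leaf n) hD
  cases m with
  | zero => exact absurd (ht t (by simp)) hleaf
  | succ m =>
    obtain ⟨h0, hz, hzm⟩ := (ht t (by simp)).resolve_left hleaf
    obtain ⟨s, z⟩ := t
    cases s with
    | zero => exact absurd rfl h0
    | pos => exact forestEquiv_of_isCopy_pos hn hw ih hzm.succ hz hG' h h'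
    | neg =>
      -- Split off the last copy of `z`. The part `G z^ω*` below it is a bounded initial segment of
      -- `w^ω`, so its height, and hence that of `z`, is at most `n`.
      have hE := (ForestEquiv.neg_absorb z).symm.append_left G
      rw [← List.append_assoc] at hE
      obtain ⟨C, D, hCD, hU, hC, hD⟩ := isCopy_append.1 (hE.isCopy hG h')
      rw [hU] at h
      have hDn : D.Nonempty := hD.nonempty hzm hz
      obtain ⟨p, -, hp, -, hpC, -⟩ := exists_cut_pos hn hw hCD hDn h
      have hp' := (ih p hp).forestEquiv hG hpC hC
      obtain ⟨l, rfl, -, hl⟩ :=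
        (rankLE_append.1 ((hp'.rankLE_iff n).1 hp)).2.exists_of_node h0
      exact (not_isCopy_final_segment hn hw hmin ih hCD hDn h hl.succ hD).elim

theorem IsDetermined.reverse {n : ℕ} {F : List SgnTree} (hF : RankLE n F) (h : IsDetermined F) :
    IsDetermined (reverseList F) := by
  rintro m G hG ⟨e⟩
  have h₁ : IsCopy G (Set.univ : Set (linSum (reverseList F))) := (isCopy_univ _).congr e
  have h₂ := (isCopy_univ (reverseList F)).reverse hF.reverse
  rw [reverseList_reverseList] at h₂
  simpa using (h.forestEquiv hG.reverse h₂ (h₁.reverse hG)).reverse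

theorem RankLE.isDetermined {n : ℕ} {F : List SgnTree} (hF : RankLE n F) : IsDetermined F := by
  have list : ∀ F : List SgnTree, (∀ t ∈ F, IsDetermined [t]) → IsDetermined F := by
    intro F hF
    induction F with
    | nil => exact isDetermined_nil
    | cons t F ih =>
      exact (hF t (by simp)).append (F' := F) (ih fun t' ht' => hF t' (by simp [ht']))
  induction n generalizing F with
  | zero => exact list F fun t ht => by rw [hF t ht]; exact isDetermined_leaf
  | succ n ih =>
    refine list F fun t ht => ?_
    rcases hF t ht with rfl | ⟨h0, h1, h2⟩
    · exact isDetermined_leaf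
    · obtain ⟨s, w⟩ := t
      cases s with
      | zero => exact absurd rfl h0
      | pos => exact .pos h2 h1 fun F hF => ih hF
      | neg =>
        have h3 : reverseList w ≠ [] := by simpa [children] using h1
        have h4 : RankLE (n + 1) [node .pos (reverseList w)] :=
          (rankLE_succ_node (by decide)).2 ⟨h3, h2.reverse⟩
        simpa [children] using (IsDetermined.pos h2.reverse h3 fun F hF => ih hF).reverse h4

/-! ### Moves on 3-signed trees and on forests -/

/-- Replacing the subtree at the address `σ` is a move of the forest below the root. -/
theorem exists_forestStep_replaceAt {f : SgnTree → List SgnTree}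
    (hf : ∀ A B t, t.rootSign ≠ 0 → ForestStep (A ++ t :: B) (A ++ f t ++ B)) {t : SgnTree}
    (ht : t.rootSign ≠ 0) :
    ∀ (σ : List ℕ) (s : SignType) (ts : List SgnTree), σ ≠ [] → (node s ts).sub σ = some t →
      ∃ ts', (node s ts).replaceAt f σ = node s ts' ∧ ForestStep ts ts'
  | [], _, _, h, _ => absurd rfl h
  | [k], s, ts, _, h => by
    have hk : ts[k]? = some t := by simpa [sub] using h
    refine ⟨_, rfl, ?_⟩
    obtain ⟨hlt, rfl⟩ := List.getElem?_eq_some_iff.1 hk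
    have := hf (ts.take k) (ts.drop (k + 1)) ts[k] ht
    rw [List.getElem_cons_drop, List.take_append_drop] at this
    simpa [hk] using this
  | k :: l :: σ, s, ts, _, h => by
    obtain ⟨⟨s', us⟩, hk, h'⟩ := Option.bind_eq_some_iff.1 h
    obtain ⟨us', e, hstep⟩ := exists_forestStep_replaceAt hf ht (l :: σ) s' us (by simp) h'
    refine ⟨_, rfl, ?_⟩
    obtain ⟨hlt, hkl⟩ := List.getElem?_eq_some_iff.1 hk
    have := ForestStep.node (ts.take k) (ts.drop (k + 1)) s' hstep
    rw [← e, ← hkl, List.getElem_cons_drop, List.take_append_drop] at this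
    rwa [List.modify_eq_take_cons_drop hlt]

/-- Every move of a forest is `EXUDE` or `REPL` at some vertex of the tree obtained by adding
a root. -/
theorem ForestStep.exists_address {F G : List SgnTree} (h : ForestStep F G) :
    ∃ σ t, σ ≠ [] ∧ t.rootSign ≠ 0 ∧ (∀ s, (SgnTree.node s F).sub σ = some t) ∧
      ((∀ s, (SgnTree.node s F).replaceAt exudeList σ = SgnTree.node s G) ∨
        ∃ m, 1 ≤ m ∧ ∀ s, (SgnTree.node s F).replaceAt (replList m) σ = SgnTree.node s G) := by
  induction h with
  | exude A B t ht =>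
    exact ⟨[A.length], t, by simp, ht, by simp [sub], Or.inl (by simp [replaceAt])⟩
  | repl A B t ht m hm =>
    exact ⟨[A.length], t, by simp, ht, by simp [sub], Or.inr ⟨m, hm, by simp [replaceAt]⟩⟩
  | node A B s h ih =>
    obtain ⟨σ, t, hσ, ht, hsub, h'⟩ := ih
    obtain ⟨l, σ, rfl⟩ := List.exists_cons_of_ne_nil hσ
    have hmod : ∀ (x : SgnTree) (g : SgnTree → SgnTree),
        (A ++ x :: B).modify A.length g = A ++ g x :: B := fun x g => by
      rw [List.modify_eq_take_cons_drop (by simp)]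
      simp
    refine ⟨A.length :: l :: σ, t, by simp, ht, fun s' => ?_, ?_⟩
    · rw [sub]
      simpa using hsub s
    · refine h'.imp (fun h' s' => ?_) (fun ⟨m, hm, h'⟩ => ⟨m, hm, fun s' => ?_⟩) <;>
        rw [replaceAt, hmod, h']

end SgnTree

namespace ThreeSignedTree

open SgnTree

theorem exists_rankLE_children (T : ThreeSignedTree) : ∃ n, RankLE n T.1.children := by
  obtain ⟨⟨s, ts⟩, hT⟩ := T
  exact exists_rankLE_of_forall fun t ht =>
    ((isThreeSigned_node _ _).1 hT).2 t ht |>.exists_rankLE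

theorem LStep.forestStep {T T' : ThreeSignedTree} (h : LStep T T') :
    ForestStep T.1.children T'.1.children := by
  have key : ∀ (T : ThreeSignedTree) (σ : List ℕ), T.SignNeZero σ →
      ∀ f : SgnTree → List SgnTree,
        (∀ A B t, t.rootSign ≠ 0 → ForestStep (A ++ t :: B) (A ++ f t ++ B)) →
        ForestStep T.1.children (T.1.replaceAt f σ).children := by
    rintro ⟨⟨s, ts⟩, hT⟩ σ ⟨t, hσ, ht⟩ f hf
    have hσ0 : σ ≠ [] := fun h => ht ((hT σ t hσ).2 (Or.inl h))
    obtain ⟨ts', e, h⟩ := exists_forestStep_replaceAt hf ht σ s ts hσ0 hσ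
    rw [e]
    exact h
  cases h with
  | exude σ hσ => exact key T σ hσ _ fun A B t ht => .exude A B t ht
  | repl σ hσ m hm => exact key T σ hσ _ fun A B t ht => .repl A B t ht m hm

theorem LEquiv.forestEquiv {T T' : ThreeSignedTree} (h : LEquiv T T') :
    ForestEquiv T.1.children T'.1.children := by
  induction h with
  | rel T T' h => exact .rel _ _ h.forestStep
  | refl T => exact .refl _
  | symm T T' _ ih => exact ih.symm
  | trans T T' T'' _ _ ih ih' => exact ih.trans ih'

/-- The 3-signed tree whose child subtrees are the trees of `F`. -/
def ofForest {n : ℕ} (F : List SgnTree) (hF : RankLE n F) : ThreeSignedTree :=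
  ⟨.node 0 F, (isThreeSigned_node _ _).2 ⟨rfl, hF.isBranch⟩⟩

theorem eq_ofForest (T : ThreeSignedTree) {n : ℕ} (hT : RankLE n T.1.children) :
    T = ofForest T.1.children hT := by
  obtain ⟨⟨s, ts⟩, h⟩ := T
  obtain rfl := ((isThreeSigned_node _ _).1 h).1
  rfl

theorem lStep_ofForest {n : ℕ} {F G : List SgnTree} (h : ForestStep F G) (hF : RankLE n F)
    (hG : RankLE n G) : LStep (ofForest F hF) (ofForest G hG) := by
  obtain ⟨σ, t, -, ht, hsub, h' | ⟨m, hm, h'⟩⟩ := h.exists_address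
  · have e : ofForest G hG = (ofForest F hF).exude σ := Subtype.ext (h' 0).symm
    exact e ▸ .exude _ _ ⟨t, hsub 0, ht⟩
  · have e : ofForest G hG = (ofForest F hF).repl m hm σ := Subtype.ext (h' 0).symm
    exact e ▸ .repl _ _ ⟨t, hsub 0, ht⟩ m hm

theorem lEquiv_ofForest {n : ℕ} {F G : List SgnTree} (h : ForestEquiv F G) (hF : RankLE n F)
    (hG : RankLE n G) : LEquiv (ofForest F hF) (ofForest G hG) := by
  induction h with
  | rel F G h => exact .rel _ _ (lStep_ofForest h hF hG)
  | refl F => exact .refl _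
  | symm F G _ ih => exact .symm _ _ (ih hG hF)
  | trans F H G h _ ih ih' =>
    have hH := (ForestEquiv.rankLE_iff h n).1 hF
    exact .trans _ _ _ (ih hF hH) (ih' hH hG)

theorem lEquiv_of_forestEquiv {T T' : ThreeSignedTree}
    (h : ForestEquiv T.1.children T'.1.children) : LEquiv T T' := by
  obtain ⟨n, hn⟩ := T.exists_rankLE_children
  rw [T.eq_ofForest hn, T'.eq_ofForest ((h.rankLE_iff n).1 hn)]
  exact lEquiv_ofForest h _ _

/-- The root has sign `0` and contributes only a factor `1`. -/
theorem nonempty_LIN_orderIso (T : ThreeSignedTree) : Nonempty (T.LIN ≃o linSum T.1.children) := by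
  obtain ⟨⟨s, ts⟩, hT⟩ := T
  obtain rfl := ((isThreeSigned_node _ _).1 hT).1
  cases ts with
  | nil => exact ⟨OrderIso.refl Empty⟩
  | cons t ts =>
    change Nonempty ((Unit ×ₗ linSum (t :: ts)) ≃o linSum (t :: ts))
    obtain ⟨S, -, hU, hS⟩ := copy_lex_prod.1 (copy_univ (Unit ×ₗ linSum (t :: ts)))
    have hS' := hS ()
    rw [← Set.iUnion_const (ι := Unit) (S ())] at hS'
    exact (copy_univ _).nonempty_orderIso (hU ▸ hS')

end ThreeSignedTree

/-! ### Finitely presented linear orders -/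

namespace SgnTree

theorem nonempty_linSum_append (F G : List SgnTree) :
    Nonempty (linSum (F ++ G) ≃o linSum F ⊕ₗ linSum G) := by
  have h := copy_univ (linSum F ⊕ₗ linSum G)
  exact Copy.nonempty_orderIso (isCopy_append.2 (copy_sum.1 h)) h

theorem nonempty_linSum_node (s : SignType) {F : List SgnTree} (hF : F ≠ []) :
    Nonempty (linSum [node s F] ≃o omegaPow s ×ₗ linSum F) := by
  have h := copy_univ (omegaPow s ×ₗ linSum F)
  exact Copy.nonempty_orderIso ((isCopy_node hF).2 (copy_lex_prod.1 h)) h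

theorem nonempty_linSum_leaf : Nonempty (linSum [node 0 []] ≃o Unit) := by
  have h := copy_univ Unit
  exact Copy.nonempty_orderIso (isCopy_leaf.2 (copy_unit.1 h)) h

/-- `ω^s × L` is presented by a forest of height `n + 1` if `L` is by one of height `n`. For empty
`L` this is the empty forest, since the vertices of nonzero sign have children. -/
theorem exists_forest_lex_prod {s : SignType} (hs : s ≠ 0) {L : Type u} [LinearOrder L]
    {F : List SgnTree} {n : ℕ} (hF : RankLE n F) (e : L ≃o linSum F) :
    ∃ n F', RankLE n F' ∧ Nonempty ((omegaPow s ×ₗ L) ≃o linSum F') := by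
  by_cases h0 : F = []
  · subst h0
    have : IsEmpty L := e.toEquiv.isEmpty_congr.2 (inferInstanceAs (IsEmpty Empty))
    have : IsEmpty (omegaPow s ×ₗ L) := inferInstanceAs (IsEmpty (omegaPow s × L))
    exact ⟨0, [], by simp, ⟨OrderIso.ofIsEmpty _ Empty⟩⟩
  · obtain ⟨e'⟩ := nonempty_linSum_node s h0
    exact ⟨n + 1, [node s F], (rankLE_succ_node hs).2 ⟨h0, hF⟩,
      ⟨(Prod.Lex.prodLexCongr (OrderIso.refl _) e).trans e'.symm⟩⟩

theorem _root_.IsFinitelyPresented.exists_forest {L : Type u} [LinearOrder L]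
    (h : IsFinitelyPresented L) : ∃ n F, RankLE n F ∧ Nonempty (L ≃o linSum F) := by
  induction h with
  | iso e _ ih =>
    obtain ⟨n, F, hF, ⟨e'⟩⟩ := ih
    exact ⟨n, F, hF, ⟨e.symm.trans e'⟩⟩
  | zero => exact ⟨0, [], by simp, ⟨OrderIso.ofIsEmpty _ Empty⟩⟩
  | one =>
    obtain ⟨e⟩ := nonempty_linSum_leaf
    exact ⟨0, [node 0 []], by simp, ⟨(OrderIso.ofUnique PUnit Unit).trans e.symm⟩⟩
  | add _ _ ih₁ ih₂ =>
    obtain ⟨n, F, hF, ⟨e₁⟩⟩ := ih₁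
    obtain ⟨m, G, hG, ⟨e₂⟩⟩ := ih₂
    obtain ⟨e⟩ := nonempty_linSum_append F G
    exact ⟨max n m, F ++ G,
      rankLE_append.2 ⟨hF.mono (le_max_left _ _), hG.mono (le_max_right _ _)⟩,
      ⟨(OrderIso.sumLexCongr e₁ e₂).trans e.symm⟩⟩
  | omega_mul _ ih =>
    obtain ⟨n, F, hF, ⟨e⟩⟩ := ih
    exact exists_forest_lex_prod (s := .pos) (by decide) hF e
  | omega_star_mul _ ih =>
    obtain ⟨n, F, hF, ⟨e⟩⟩ := ih
    exact exists_forest_lex_prod (s := .neg) (by decide) hF e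

/-- The order is built anew in the universe `u`, because `linSum F` lives in `Type`. -/
theorem RankLE.exists_isFinitelyPresented {n : ℕ} {F : List SgnTree} (hF : RankLE n F) :
    ∃ (L : Type u) (_ : LinearOrder L), IsFinitelyPresented L ∧ Nonempty (L ≃o linSum F) := by
  have list : ∀ F : List SgnTree,
      (∀ t ∈ F, ∃ (L : Type u) (_ : LinearOrder L),
        IsFinitelyPresented L ∧ Nonempty (L ≃o linSum [t])) →
      ∃ (L : Type u) (_ : LinearOrder L), IsFinitelyPresented L ∧ Nonempty (L ≃o linSum F) := by
    intro F hF
    induction F with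
    | nil => exact ⟨PEmpty, inferInstance, .zero, ⟨OrderIso.ofIsEmpty _ Empty⟩⟩
    | cons t F ih =>
      obtain ⟨L, _, hL, ⟨e⟩⟩ := hF t (by simp)
      obtain ⟨M, _, hM, ⟨e'⟩⟩ := ih fun t' ht' => hF t' (by simp [ht'])
      obtain ⟨e''⟩ := nonempty_linSum_append [t] F
      exact ⟨L ⊕ₗ M, inferInstance, .add hL hM, ⟨(OrderIso.sumLexCongr e e').trans e''.symm⟩⟩
  have leaf : ∃ (L : Type u) (_ : LinearOrder L),
      IsFinitelyPresented L ∧ Nonempty (L ≃o linSum [node 0 []]) := by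
    obtain ⟨e⟩ := nonempty_linSum_leaf
    exact ⟨PUnit, inferInstance, .one, ⟨(OrderIso.ofUnique PUnit Unit).trans e.symm⟩⟩
  induction n generalizing F with
  | zero => exact list F fun t ht => by rw [hF t ht]; exact leaf
  | succ n ih =>
    refine list F fun t ht => ?_
    rcases hF t ht with rfl | ⟨h0, h1, h2⟩
    · exact leaf
    · obtain ⟨s, w⟩ := t
      obtain ⟨L, _, hL, ⟨e⟩⟩ := ih h2
      obtain ⟨e'⟩ := nonempty_linSum_node s h1
      cases s with
      | zero => exact absurd rfl h0
      | pos => exact ⟨ℕ ×ₗ L, inferInstance, .omega_mul hL,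
          ⟨(Prod.Lex.prodLexCongr (OrderIso.refl ℕ) e).trans e'.symm⟩⟩
      | neg => exact ⟨ℕᵒᵈ ×ₗ L, inferInstance, .omega_star_mul hL,
          ⟨(Prod.Lex.prodLexCongr (OrderIso.refl ℕᵒᵈ) e).trans e'.symm⟩⟩

end SgnTree

/-- Two 3-signed trees have isomorphic linear orders if and only if they are L-equivalent, and the
linear orders of 3-signed trees are, up to isomorphism, precisely the finitely presented ones. -/
theorem mainTheorem1 :
    (∀ T T' : ThreeSignedTree, Nonempty (T.LIN ≃o T'.LIN) → ThreeSignedTree.LEquiv T T') ∧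
    (∀ T T' : ThreeSignedTree, ThreeSignedTree.LEquiv T T' → Nonempty (T.LIN ≃o T'.LIN)) ∧
    (∀ (L : Type u) [LinearOrder L],
      IsFinitelyPresented L ↔ ∃ T : ThreeSignedTree, Nonempty (L ≃o T.LIN)) := by
  refine ⟨fun T T' ⟨e⟩ => ?_, fun T T' h => ?_, fun L _ => ⟨fun h => ?_, fun ⟨T, ⟨e⟩⟩ => ?_⟩⟩
  · obtain ⟨n, hn⟩ := T.exists_rankLE_children
    obtain ⟨m, hm⟩ := T'.exists_rankLE_children
    obtain ⟨e₁⟩ := T.nonempty_LIN_orderIso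
    obtain ⟨e₂⟩ := T'.nonempty_LIN_orderIso
    exact ThreeSignedTree.lEquiv_of_forestEquiv
      (hn.isDetermined m _ hm ⟨(e₁.symm.trans e).trans e₂⟩)
  · obtain ⟨n, hn⟩ := T.exists_rankLE_children
    obtain ⟨e₁⟩ := T.nonempty_LIN_orderIso
    obtain ⟨e₂⟩ := T'.nonempty_LIN_orderIso
    obtain ⟨e⟩ := h.forestEquiv.nonempty_orderIso hn
    exact ⟨(e₁.trans e).trans e₂.symm⟩
  · obtain ⟨n, F, hF, ⟨e⟩⟩ := h.exists_forest
    obtain ⟨e'⟩ := (ThreeSignedTree.ofForest F hF).nonempty_LIN_orderIso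
    exact ⟨ThreeSignedTree.ofForest F hF, ⟨e.trans e'.symm⟩⟩
  · obtain ⟨n, hn⟩ := T.exists_rankLE_children
    obtain ⟨e'⟩ := T.nonempty_LIN_orderIso
    obtain ⟨M, _, hM, ⟨f⟩⟩ := hn.exists_isFinitelyPresented
    exact .iso (f.trans (e.trans e').symm) hM
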